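/- Let $G$ be a finite simple connected graph with maximum degree $\Delta(G)\le 5$ and clique number $\omega(G)\le 4$. Suppose that for no integer $l\ge 2$ is $G$ isomorphic to the strong product $C_{2l+1}\boxtimes K_2$. Then there is an independent set $I\subseteq V(G)$ that meets every induced copy of $K_4$ in $G$ and every induced copy of $C_8^2$ in $G$; that is, $I\cap S\neq\emptyset$ for every $S\subseteq V(G)$ such that the induced subgraph $G[S]$ is isomorphic to $K_4$ or to $C_8^2$. Here $C_n$ is the cycle on $n$ vertices and $K_n$ the complete graph on $n$ vertices. The strong product $G_1\boxtimes G_2$ has vertex set $V(G_1)\times V(G_2)$, with $(a,x)$ and $(b,y)$ adjacent if and only if ($a=b$ and $xy\in E(G_2)$), or ($ab\in E(G_1)$ and $x=y$), or ($ab\in E(G_1)$ and $xy\in E(G_2)$). The graph $C_8^2$ is the square of $C_8$: it has the same vertices, and two distinct vertices are adjacent if and only if their distance in $C_8$ is at most $2$. -/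

import Mathlib

namespace FracBrooks

/-- The strong product of two graphs: `(a, x)` and `(b, y)` are adjacent if `a = b` and
`x y` is an edge, or `a b` is an edge and `x = y`, or both `a b` and `x y` are edges. -/
def strongProduct {α β : Type*} (G : SimpleGraph α) (H : SimpleGraph β) :
    SimpleGraph (α × β) where
  Adj p q :=
    (p.1 = q.1 ∧ H.Adj p.2 q.2) ∨ (G.Adj p.1 q.1 ∧ p.2 = q.2) ∨
      (G.Adj p.1 q.1 ∧ H.Adj p.2 q.2)
  symm := ⟨fun p q h => by
    rcases h with ⟨h₁, h₂⟩ | ⟨h₁, h₂⟩ | ⟨h₁, h₂⟩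
    · exact Or.inl ⟨h₁.symm, h₂.symm⟩
    · exact Or.inr (Or.inl ⟨h₁.symm, h₂.symm⟩)
    · exact Or.inr (Or.inr ⟨h₁.symm, h₂.symm⟩)⟩
  loopless := ⟨fun p h => by
    rcases h with ⟨_, h₂⟩ | ⟨h₁, _⟩ | ⟨h₁, _⟩
    · exact H.loopless.irrefl _ h₂
    · exact G.loopless.irrefl _ h₁
    · exact G.loopless.irrefl _ h₁⟩

/-- The square of a graph: two distinct vertices are adjacent if they are joined by a path
with one or two edges. -/
def square {α : Type*} (G : SimpleGraph α) : SimpleGraph α where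
  Adj u v := u ≠ v ∧ (G.Adj u v ∨ ∃ w, G.Adj u w ∧ G.Adj w v)
  symm := ⟨fun u v h => by
    obtain ⟨hne, h | ⟨w, h₁, h₂⟩⟩ := h
    · exact ⟨hne.symm, Or.inl h.symm⟩
    · exact ⟨hne.symm, Or.inr ⟨w, h₂.symm, h₁.symm⟩⟩⟩
  loopless := ⟨fun _ h => h.1 rfl⟩

/-- The vertex set `I` meets every induced copy of `H` in `G`. -/
def MeetsInducedCopies {α V : Type*} (I : Set V) (H : SimpleGraph α) (G : SimpleGraph V) :
    Prop :=
  ∀ f : H ↪g G, ∃ a, f a ∈ I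

end FracBrooks

/-! Call the vertex sets of `K₄`s and of induced `C₈²`s targets. Overlapping targets generate an
equivalence relation whose classes, the clusters, partition the vertices, so each target lies in one
cluster. It is enough to find in each cluster an independent set meeting its targets, of which only
one vertex `p` may have neighbours outside the cluster, and to choose these vertices `p` pairwise
nonadjacent.

Degree at most 5 makes clusters rigid. They contain a `C₈²`, or `K₄`s sharing a triangle, or a chain
of pairs in which consecutive pairs form `K₄`s, or a single `K₄`. In each case either some `p` has
no neighbour outside the cluster, or there is a set `P` of candidates each with at most `min(2, |P|
- 2)` outside neighbours (`HasChoice`, proved in `hasChoice_of_isCluster`). The only obstruction is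
a chain closing up into an odd number of pairs. It is then the whole connected graph, hence an
excluded product, or, for three pairs, it contains a `K₅`.

The candidates are chosen by a lopsided version of Haxell's theorem on independent transversals,
`exists_independent_transversal`: a failure would give a small set dominating many classes, against
a degree count. -/

/-! ### Independent transversals. -/

/-- `f` picks, for each index in `A`, a vertex of `W` of that colour, such that no two picked
vertices are adjacent. -/
def IsTransversalOn {ι V : Type*} (G : SimpleGraph V) (A : Finset ι) (c : V → ι) (W : Finset V)
    (f : ι → V) : Prop :=
  (∀ i ∈ A, f i ∈ W ∧ c (f i) = i) ∧ ∀ i ∈ A, ∀ j ∈ A, i ≠ j → ¬ G.Adj (f i) (f j)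

theorem IsTransversalOn.mono {ι V : Type*} {G H : SimpleGraph V} {A : Finset ι} {c : V → ι}
    {W : Finset V} {f : ι → V} (h : IsTransversalOn G A c W f) (hle : H ≤ G) :
    IsTransversalOn H A c W f :=
  ⟨h.1, fun i hi j hj hij hadj => h.2 i hi j hj hij (hle hadj)⟩

/-- If there is no independent transversal, but there is one as soon as the class `a` is dropped,
then some union of classes is dominated by few vertices, meeting each of these classes. -/
theorem exists_dominating_of_no_transversal {ι V : Type*} [DecidableEq ι] [DecidableEq V]
    [Finite V] (n : ℕ) :
    ∀ (A : Finset ι) (c : V → ι) (W : Finset V) (G : SimpleGraph V) (a : ι), A.card = n → a ∈ A →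
    (¬ ∃ f, IsTransversalOn G A c W f) → (∃ f, IsTransversalOn G (A.erase a) c W f) →
    ∃ J ⊆ A, a ∈ J ∧ ∃ D : Finset V, D.card + 2 ≤ 2 * J.card ∧
      (∀ d ∈ D, d ∈ W ∧ c d ∈ J ∧ ∃ e ∈ W, G.Adj d e) ∧
      (J = {a} ∧ D = ∅ ∨ ∀ i ∈ J, ∃ d ∈ D, c d = i) ∧
      ∀ v ∈ W, c v ∈ J → ∃ d ∈ D, G.Adj d v := by
  classical
  induction n with
  | zero =>
    intro A c W G a hA ha
    rw [Finset.card_eq_zero] at hA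
    simp [hA] at ha
  | succ n ih =>
    intro A c W G a hA ha hno hex
    -- In an edge-minimal `H`, deleting any edge creates a transversal, which must use both ends of
    -- that edge.
    obtain ⟨H, ⟨hHG, hHno⟩, hHmin⟩ := (wellFounded_lt (α := SimpleGraph V)).has_min
      {H | H ≤ G ∧ ¬ ∃ f, IsTransversalOn H A c W f} ⟨G, le_rfl, hno⟩
    obtain ⟨f₀, hf₀⟩ := hex
    replace hf₀ := hf₀.mono hHG
    by_cases hv : ∃ v ∈ W, c v = a
    swap
    · refine ⟨{a}, by simpa using ha, by simp, ∅, by simp, by simp, by simp, ?_⟩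
      intro v hvW hva
      exact absurd ⟨v, hvW, by simpa using hva⟩ hv
    obtain ⟨v, hvW, hva⟩ := hv
    -- Otherwise `v` would extend the partial transversal `f₀`.
    obtain ⟨b, hbA, hvb⟩ : ∃ b ∈ A.erase a, H.Adj v (f₀ b) := by
      by_contra hcon
      push Not at hcon
      refine hHno ⟨Function.update f₀ a v, ?_, ?_⟩
      · intro i hi
        by_cases hia : i = a
        · subst hia; simp [hvW, hva]
        · simpa [Function.update_of_ne hia] using hf₀.1 i (Finset.mem_erase.2 ⟨hia, hi⟩)
      · intro i hi j hj hij
        by_cases hia : i = a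
        · subst hia
          rw [Function.update_self, Function.update_of_ne hij.symm]
          exact hcon j (Finset.mem_erase.2 ⟨hij.symm, hj⟩)
        · by_cases hja : j = a
          · subst hja
            rw [Function.update_self, Function.update_of_ne hia, H.adj_comm]
            exact hcon i (Finset.mem_erase.2 ⟨hij, hi⟩)
          · rw [Function.update_of_ne hia, Function.update_of_ne hja]
            exact hf₀.2 i (Finset.mem_erase.2 ⟨hia, hi⟩) j (Finset.mem_erase.2 ⟨hja, hj⟩) hij
    obtain ⟨hyW, hyb⟩ := hf₀.1 b hbA
    generalize f₀ b = y at hvb hyW hyb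
    obtain ⟨hba, hbA⟩ := Finset.mem_erase.1 hbA
    obtain ⟨M, hM⟩ : ∃ M, IsTransversalOn (H.deleteEdges {s(v, y)}) A c W M := by
      by_contra hcon
      refine hHmin (H.deleteEdges {s(v, y)}) ⟨(H.deleteEdges_le _).trans hHG, hcon⟩ ?_
      refine lt_of_le_of_ne (H.deleteEdges_le _) fun heq => ?_
      rw [← heq] at hvb
      simp at hvb
    have hMab : M a = v ∧ M b = y := by
      by_contra hcon
      refine hHno ⟨M, hM.1, fun i hi j hj hij hadj => ?_⟩
      have h1 := hM.2 i hi j hj hij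
      simp only [SimpleGraph.deleteEdges_adj, hadj, true_and, Set.mem_singleton_iff,
        not_not, Sym2.eq_iff] at h1
      have hi' := (hM.1 i hi).2
      have hj' := (hM.1 j hj).2
      rcases h1 with ⟨h1, h2⟩ | ⟨h1, h2⟩
      · rw [h1] at hi'; rw [h2] at hj'
        have e1 : i = a := hi'.symm.trans hva
        have e2 : j = b := hj'.symm.trans hyb
        exact hcon ⟨e1 ▸ h1, e2 ▸ h2⟩
      · rw [h1] at hi'; rw [h2] at hj'
        have e1 : i = b := hi'.symm.trans hyb
        have e2 : j = a := hj'.symm.trans hva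
        exact hcon ⟨e2 ▸ h2, e1 ▸ h1⟩
    obtain ⟨hMa, hMb⟩ := hMab
    -- Merge class `b` into class `a` and delete what `v` and `y` dominate. One class fewer pays for
    -- the two vertices `v`, `y` added to `D`.
    set c' : V → ι := fun u => if c u = b then a else c u with hc'
    set W' : Finset V := W.filter fun u => ¬ H.Adj v u ∧ ¬ H.Adj y u with hW'
    have hc'b : ∀ u, c u = b → c' u = a := fun u hu => by simp [hc', hu]
    have hc'n : ∀ u, c u ≠ b → c' u = c u := fun u hu => by simp [hc', hu]
    have hc'i : ∀ u i, i ≠ a → c' u = i → c u = i := by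
      intro u i hia hu
      by_cases h : c u = b
      · exact absurd ((hc'b u h).symm.trans hu).symm hia
      · rw [← hc'n u h, hu]
    obtain ⟨J, hJA, haJ, D, hcard, hD, htouch, hdom⟩ := ih (A.erase b) c' W' H a
      (by rw [Finset.card_erase_of_mem hbA, hA]; rfl) (Finset.mem_erase.2 ⟨hba.symm, ha⟩)
      (by
        rintro ⟨g, hg1, hg2⟩
        have haA' : a ∈ A.erase b := Finset.mem_erase.2 ⟨hba.symm, ha⟩
        have hgW : ∀ i ∈ A.erase b, g i ∈ W ∧ ¬ H.Adj v (g i) ∧ ¬ H.Adj y (g i) := by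
          intro i hi
          have := (hg1 i hi).1
          simpa [hW'] using this
        have hgc : ∀ i ∈ A.erase b, i ≠ a → c (g i) = i := fun i hi hia =>
          hc'i _ i hia (hg1 i hi).2
        -- A transversal `g` of the merged classes picks a vertex of old class `a` or `b`. Adding
        -- `v` or `y` for the other class would give a transversal of `H`.
        by_cases hga : c (g a) = b
        · refine hHno ⟨Function.update (Function.update g b (g a)) a v, ?_, ?_⟩
          · intro i hi
            by_cases hia : i = a
            · subst hia; simp [hvW, hva]
            by_cases hib : i = b
            · subst hib; simp [Function.update_of_ne hia, hga, (hgW a haA').1]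
            · rw [Function.update_of_ne hia, Function.update_of_ne hib]
              have := Finset.mem_erase.2 ⟨hib, hi⟩
              exact ⟨(hgW i this).1, hgc i this hia⟩
          · have key : ∀ i ∈ A, i ≠ a → ¬ H.Adj v (Function.update g b (g a) i) := by
              intro i hi hia
              by_cases hib : i = b
              · subst hib; rw [Function.update_self]; exact (hgW a haA').2.1
              · rw [Function.update_of_ne hib]
                exact (hgW i (Finset.mem_erase.2 ⟨hib, hi⟩)).2.1
            intro i hi j hj hij
            by_cases hia : i = a
            · subst hia
              rw [Function.update_self, Function.update_of_ne hij.symm]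
              exact key j hj hij.symm
            by_cases hja : j = a
            · subst hja
              rw [Function.update_self, Function.update_of_ne hij, H.adj_comm]
              exact key i hi hij
            rw [Function.update_of_ne hia, Function.update_of_ne hja]
            by_cases hib : i = b
            · subst hib
              rw [Function.update_self, Function.update_of_ne hij.symm]
              exact hg2 a haA' j (Finset.mem_erase.2 ⟨hij.symm, hj⟩) (Ne.symm hja)
            by_cases hjb : j = b
            · subst hjb
              rw [Function.update_self, Function.update_of_ne hij]
              exact hg2 i (Finset.mem_erase.2 ⟨hij, hi⟩) a haA' hia
            rw [Function.update_of_ne hib, Function.update_of_ne hjb]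
            exact hg2 i (Finset.mem_erase.2 ⟨hib, hi⟩) j (Finset.mem_erase.2 ⟨hjb, hj⟩) hij
        · have hga' : c (g a) = a := by rw [← hc'n _ hga, (hg1 a haA').2]
          refine hHno ⟨Function.update g b y, ?_, ?_⟩
          · intro i hi
            by_cases hib : i = b
            · subst hib; simp [hyW, hyb]
            · rw [Function.update_of_ne hib]
              have := Finset.mem_erase.2 ⟨hib, hi⟩
              by_cases hia : i = a
              · subst hia; exact ⟨(hgW i this).1, hga'⟩
              · exact ⟨(hgW i this).1, hgc i this hia⟩
          · intro i hi j hj hij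
            by_cases hib : i = b
            · subst hib
              rw [Function.update_self, Function.update_of_ne hij.symm]
              exact (hgW j (Finset.mem_erase.2 ⟨hij.symm, hj⟩)).2.2
            by_cases hjb : j = b
            · subst hjb
              rw [Function.update_self, Function.update_of_ne hij, H.adj_comm]
              exact (hgW i (Finset.mem_erase.2 ⟨hij, hi⟩)).2.2
            rw [Function.update_of_ne hib, Function.update_of_ne hjb]
            exact hg2 i (Finset.mem_erase.2 ⟨hib, hi⟩) j (Finset.mem_erase.2 ⟨hjb, hj⟩) hij)
      (by
        refine ⟨M, ?_, ?_⟩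
        · intro i hi
          simp only [Finset.mem_erase] at hi
          obtain ⟨hia, hib, hi⟩ := hi
          obtain ⟨h1, h2⟩ := hM.1 i hi
          refine ⟨?_, by rw [hc'n _ (by rwa [h2]), h2]⟩
          have hne1 : M i ≠ y := fun h => hib (by rw [← h2, h, hyb])
          have hne2 : M i ≠ v := fun h => hia (by rw [← h2, h, hva])
          have h3 := hM.2 a ha i hi (Ne.symm hia)
          have h4 := hM.2 b hbA i hi (Ne.symm hib)
          rw [hMa] at h3
          rw [hMb] at h4
          simp only [hW', Finset.mem_filter]
          refine ⟨h1, fun h => h3 ?_, fun h => h4 ?_⟩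
          · simp [h, hne1, hne2]
          · simp [h, hne1, hne2]
        · intro i hi j hj hij hadj
          simp only [Finset.mem_erase] at hi hj
          have h3 := hM.2 i hi.2.2 j hj.2.2 hij
          have hne1 : M i ≠ y := fun h => hi.2.1 (by rw [← (hM.1 i hi.2.2).2, h, hyb])
          have hne2 : M i ≠ v := fun h => hi.1 (by rw [← (hM.1 i hi.2.2).2, h, hva])
          exact h3 (by simp [hadj, hne1, hne2]))
    have hbJ : b ∉ J := fun h => (Finset.mem_erase.1 (hJA h)).1 rfl
    refine ⟨insert b J, ?_, Finset.mem_insert_of_mem haJ, insert v (insert y D), ?_, ?_,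
      Or.inr ?_, ?_⟩
    · exact Finset.insert_subset hbA (hJA.trans (Finset.erase_subset _ _))
    · rw [Finset.card_insert_of_notMem hbJ]
      have h1 := Finset.card_insert_le v (insert y D)
      have h2 := Finset.card_insert_le y D
      omega
    · intro d hd
      rcases Finset.mem_insert.1 hd with rfl | hd
      · exact ⟨hvW, by simp [hva, haJ], y, hyW, hHG hvb⟩
      rcases Finset.mem_insert.1 hd with rfl | hd
      · exact ⟨hyW, by simp [hyb], v, hvW, hHG hvb.symm⟩
      obtain ⟨h1, h2, e, he, h3⟩ := hD d hd
      refine ⟨(Finset.mem_filter.1 h1).1, ?_, e, (Finset.mem_filter.1 he).1, hHG h3⟩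
      by_cases hdb : c d = b
      · simp [hdb]
      · rw [hc'n _ hdb] at h2
        exact Finset.mem_insert_of_mem h2
    · intro i hi
      rcases Finset.mem_insert.1 hi with rfl | hi
      · exact ⟨y, by simp, hyb⟩
      by_cases hia : i = a
      · exact ⟨v, by simp, by rw [hva, hia]⟩
      rcases htouch with ⟨rfl, -⟩ | htouch
      · simp [hia] at hi
      · obtain ⟨d, hd, hdi⟩ := htouch i hi
        exact ⟨d, by simp [hd], hc'i d i hia hdi⟩
    · intro u hu huJ
      by_cases h1 : H.Adj v u
      · exact ⟨v, by simp, hHG h1⟩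
      by_cases h2 : H.Adj y u
      · exact ⟨y, by simp, hHG h2⟩
      have huJ' : c' u ∈ J := by
        by_cases hub : c u = b
        · rwa [hc'b u hub]
        · rw [hc'n u hub]
          exact Finset.mem_of_mem_insert_of_ne huJ hub
      obtain ⟨d, hd, hdu⟩ := hdom u (Finset.mem_filter.2 ⟨hu, h1, h2⟩) huJ'
      exact ⟨d, by simp [hd], hHG hdu⟩

/-- A lopsided independent transversal theorem: vertices have no neighbour in other parts, or at
most two, and at most two less than the size of their part. -/
theorem exists_independent_transversal {ι V : Type*} [Finite ι] [Finite V]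
    (G : SimpleGraph V) (P : ι → Finset V) (hne : ∀ i, (P i).Nonempty)
    (hdisj : ∀ i j v, v ∈ P i → v ∈ P j → i = j)
    (hdeg : ∀ i, ∀ v ∈ P i, (∀ j, j ≠ i → ∀ u ∈ P j, ¬ G.Adj v u) ∨
      ∀ s : Finset V, (∀ u ∈ s, G.Adj v u ∧ ∃ j, j ≠ i ∧ u ∈ P j) →
        s.card ≤ 2 ∧ s.card + 2 ≤ (P i).card) :
    ∃ f : ι → V, (∀ i, f i ∈ P i) ∧ ∀ i j, i ≠ j → ¬ G.Adj (f i) (f j) := by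
  classical
  cases nonempty_fintype ι
  cases nonempty_fintype V
  rcases isEmpty_or_nonempty ι with hι | hι
  · exact ⟨fun i => isEmptyElim i, fun i => isEmptyElim i, fun i => isEmptyElim i⟩
  obtain ⟨i₀⟩ := hι
  let c : V → ι := fun v => if h : ∃ i, v ∈ P i then h.choose else i₀
  have hc : ∀ i v, v ∈ P i → c v = i := by
    intro i v hv
    have h : ∃ i, v ∈ P i := ⟨i, hv⟩
    simp only [c, dif_pos h]
    exact hdisj _ _ v h.choose_spec hv
  let W : Finset V := Finset.univ.biUnion P
  have hW : ∀ v, v ∈ W ↔ v ∈ P (c v) := by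
    intro v
    simp only [W, Finset.mem_biUnion, Finset.mem_univ, true_and]
    exact ⟨fun ⟨i, hi⟩ => by rwa [hc i v hi], fun h => ⟨_, h⟩⟩
  let G₀ : SimpleGraph V :=
    { Adj := fun u v => G.Adj u v ∧ c u ≠ c v
      symm := ⟨fun u v h => ⟨h.1.symm, h.2.symm⟩⟩
      loopless := ⟨fun u h => h.2 rfl⟩ }
  suffices h : ∃ f, IsTransversalOn G₀ Finset.univ c W f by
    obtain ⟨f, hf1, hf2⟩ := h
    refine ⟨f, fun i => ?_, fun i j hij hadj => hf2 i (by simp) j (by simp) hij ⟨hadj, ?_⟩⟩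
    · have := hf1 i (Finset.mem_univ i)
      have h2 := (hW _).1 this.1
      rwa [this.2] at h2
    · rwa [(hf1 i (by simp)).2, (hf1 j (by simp)).2]
  by_contra hno
  obtain ⟨A, hA, hAmin⟩ := (wellFounded_lt (α := Finset ι)).has_min
    {A | ¬ ∃ f, IsTransversalOn G₀ A c W f} ⟨_, hno⟩
  obtain ⟨a, ha⟩ : A.Nonempty := by
    rw [Finset.nonempty_iff_ne_empty]
    rintro rfl
    exact hA ⟨fun i => (hne i).choose, by simp [IsTransversalOn]⟩
  obtain ⟨J, -, haJ, D, hcard, hD, htouch, hdom⟩ :=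
    exists_dominating_of_no_transversal A.card A c W G₀ a rfl ha hA
      (by
        by_contra hcon
        exact hAmin _ hcon (Finset.erase_ssubset ha))
  have hPW : ∀ i, ∀ v ∈ P i, v ∈ W := fun i v hv => by rw [hW, hc i v hv]; exact hv
  rcases htouch with ⟨rfl, rfl⟩ | htouch
  · obtain ⟨v, hv⟩ := hne a
    simpa using hdom v (hPW a v hv) (by simp [hc a v hv])
  let N : V → Finset V := fun d => W.filter fun u => G₀.Adj d u
  -- Members of `D` have a neighbour in another class, which rules out the first alternative of
  -- `hdeg`.
  have hN : ∀ d ∈ D, (N d).card ≤ 2 ∧ (N d).card + 2 ≤ (P (c d)).card := by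
    intro d hd
    obtain ⟨h1, h2, e, heW, he⟩ := hD d hd
    rcases hdeg (c d) d ((hW d).1 h1) with h3 | h3
    · exact absurd he.1 (h3 (c e) he.2.symm e ((hW e).1 heW))
    · apply h3
      intro u hu
      obtain ⟨hu1, hu2⟩ := Finset.mem_filter.1 hu
      exact ⟨hu2.1, c u, hu2.2.symm, (hW u).1 hu1⟩
  have h1 : ∑ i ∈ J, (P i).card ≤ ∑ d ∈ D, (N d).card := by
    rw [← Finset.card_biUnion (fun i _ j _ hij => Finset.disjoint_left.2
      fun v hvi hvj => hij (hdisj i j v hvi hvj))]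
    refine (Finset.card_le_card ?_).trans Finset.card_biUnion_le
    intro v hv
    obtain ⟨i, hi, hvi⟩ := Finset.mem_biUnion.1 hv
    have hvW := hPW i v hvi
    obtain ⟨d, hd, hdv⟩ := hdom v hvW (by rwa [hc i v hvi])
    exact Finset.mem_biUnion.2 ⟨d, hd, Finset.mem_filter.2 ⟨hvW, hdv⟩⟩
  have h2 : ∑ d ∈ D, (N d).card = ∑ i ∈ J, ∑ d ∈ D with c d = i, (N d).card :=
    (Finset.sum_fiberwise_of_maps_to (fun d hd => (hD d hd).2.1) _).symm
  have h3 : D.card = ∑ i ∈ J, (D.filter fun d => c d = i).card :=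
    Finset.card_eq_sum_card_fiberwise (fun d hd => (hD d hd).2.1)
  -- In class `i` one `d` satisfies `|N d| + 2 ≤ |P i|`, and the others have `|N x| ≤ 2`. Summing
  -- gives `∑ |N d| + 4|J| ≤ ∑ |P i| + 2|D|`, which contradicts `h1` since `2|D| ≤ 4|J| - 4`.
  have h4 : ∑ i ∈ J, ((∑ d ∈ D with c d = i, (N d).card) + 4) ≤
      ∑ i ∈ J, ((P i).card + 2 * (D.filter fun d => c d = i).card) := by
    refine Finset.sum_le_sum fun i hi => ?_
    obtain ⟨d, hd, hdi⟩ := htouch i hi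
    have hd' : d ∈ D.filter fun d => c d = i := Finset.mem_filter.2 ⟨hd, hdi⟩
    rw [← Finset.add_sum_erase _ _ hd', ← Finset.card_erase_add_one hd']
    have h5 : ∑ x ∈ (D.filter fun d => c d = i).erase d, (N x).card ≤
        ((D.filter fun d => c d = i).erase d).card * 2 := by
      refine Finset.sum_le_card_nsmul _ _ 2 fun x hx => ?_
      exact (hN x (Finset.mem_filter.1 (Finset.mem_of_mem_erase hx)).1).1
    have h6 := (hN d hd).2
    rw [hdi] at h6
    omega
  rw [Finset.sum_add_distrib, Finset.sum_add_distrib, ← h2, ← Finset.mul_sum, ← h3,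
    Finset.sum_const, smul_eq_mul] at h4
  omega

/-! ### Targets, clusters, and the reduction to a single cluster. -/

namespace FracBrooks

/-- A target is the vertex set of a `K₄` or of an induced `C₈²`. -/
def IsTarget {V : Type*} (G : SimpleGraph V) (T : Finset V) : Prop :=
  G.IsNClique 4 T ∨ ∃ f : square (SimpleGraph.cycleGraph 8) ↪g G, ∀ v, v ∈ T ↔ ∃ i, f i = v

/-- Every target that meets `Y` is contained in `Y`. -/
def TargetClosed {V : Type*} (G : SimpleGraph V) (Y : Set V) : Prop :=
  ∀ T, IsTarget G T → ∀ v ∈ T, v ∈ Y → ∀ u ∈ T, u ∈ Y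

/-- A cluster is an atom among the sets closed under targets. -/
structure IsCluster {V : Type*} (G : SimpleGraph V) (X : Set V) : Prop where
  closed : TargetClosed G X
  subset : ∀ Y, TargetClosed G Y → ∀ v ∈ X, v ∈ Y → X ⊆ Y

/-- The independent set `J` contains `p` and meets all targets in `X`, and only `p` may have
neighbours outside `X`. -/
structure IsHitting {V : Type*} (G : SimpleGraph V) (X : Set V) (p : V) (J : Set V) : Prop where
  mem : p ∈ J
  subset : J ⊆ X
  indep : ∀ x ∈ J, ∀ y ∈ J, ¬ G.Adj x y
  inside : ∀ x ∈ J, x ≠ p → ∀ u, G.Adj x u → u ∈ X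
  hits : ∀ T, IsTarget G T → (∀ v ∈ T, v ∈ X) → ∃ v ∈ T, v ∈ J

/-- The cluster `X` has a set `P` of candidates, with few outside neighbours, each of which extends
to an independent set hitting all targets in `X`. -/
def HasChoice {V : Type*} (G : SimpleGraph V) (X : Set V) : Prop :=
  ∃ P : Finset V, P.Nonempty ∧ (∀ p ∈ P, ∃ J, IsHitting G X p J) ∧
    ∀ p ∈ P, (∀ u, G.Adj p u → u ∈ X) ∨
      ∀ s : Finset V, (∀ u ∈ s, G.Adj p u ∧ u ∉ X) → s.card ≤ 2 ∧ s.card + 2 ≤ P.card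

theorem HasChoice.of_inside {V : Type*} {G : SimpleGraph V} {X : Set V} {p : V} {J : Set V}
    (h : IsHitting G X p J) (hp : ∀ u, G.Adj p u → u ∈ X) : HasChoice G X :=
  ⟨{p}, by simp, fun q hq => ⟨J, by rw [Finset.mem_singleton.1 hq]; exact h⟩, fun q hq =>
    Or.inl (by rw [Finset.mem_singleton.1 hq]; exact hp)⟩

theorem IsHitting.singleton {V : Type*} {G : SimpleGraph V} {X : Set V} {p : V} (hp : p ∈ X)
    (h : ∀ T, IsTarget G T → (∀ v ∈ T, v ∈ X) → p ∈ T) : IsHitting G X p {p} where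
  mem := rfl
  subset := by simpa using hp
  indep := by rintro x rfl y rfl; exact G.loopless.irrefl _
  inside := fun x hx hne => absurd hx hne
  hits := fun T hT hTX => ⟨p, h T hT hTX, rfl⟩

/-- The intersection of all closed sets containing `v` is an atom, because complements of closed
sets are closed. -/
theorem exists_isCluster {V : Type*} (G : SimpleGraph V) (v : V) : ∃ X, IsCluster G X ∧ v ∈ X := by
  refine ⟨{u | ∀ Y, TargetClosed G Y → v ∈ Y → u ∈ Y}, ⟨?_, ?_⟩, fun Y _ h => h⟩
  · intro T hT w hwT hw u huT Y hY hvY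
    exact hY T hT w hwT (hw Y hY hvY) u huT
  · intro Y hY w hw hwY
    have hvY : v ∈ Y := by
      by_contra hv
      refine hw Yᶜ ?_ hv hwY
      intro T hT a haT ha b hbT hb
      exact ha (hY T hT b hbT hb a haT)
    exact fun u hu => hu Y hY hvY

theorem IsCluster.eq_of_mem {V : Type*} {G : SimpleGraph V} {X Y : Set V} (hX : IsCluster G X)
    (hY : IsCluster G Y) {v : V} (hvX : v ∈ X) (hvY : v ∈ Y) : X = Y :=
  (hX.subset Y hY.closed v hvX hvY).antisymm (hY.subset X hX.closed v hvY hvX)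

theorem exists_isIndepSet_of_hasChoice {V : Type*} [Finite V] (G : SimpleGraph V)
    (h : ∀ X, IsCluster G X → ∀ T, IsTarget G T → (∀ v ∈ T, v ∈ X) → HasChoice G X) :
    ∃ I : Set V, G.IsIndepSet I ∧ ∀ T, IsTarget G T → T.Nonempty → ∃ v ∈ T, v ∈ I := by
  classical
  let ι := {X : Set V // IsCluster G X ∧ ∃ T, IsTarget G T ∧ ∀ v ∈ T, v ∈ X}
  have hι : ∀ X : ι, HasChoice G X.1 := fun ⟨X, hX, T, hT, hTX⟩ => h X hX T hT hTX
  choose P hPne hPJ hPdeg using hι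
  have hPX : ∀ X : ι, ∀ p ∈ P X, p ∈ X.1 := fun X p hp => by
    obtain ⟨J, hJ⟩ := hPJ X p hp
    exact hJ.subset hJ.mem
  have hdisj : ∀ (X Y : ι) (v : V), v ∈ X.1 → v ∈ Y.1 → X = Y := fun X Y v hX hY =>
    Subtype.ext (X.2.1.eq_of_mem Y.2.1 hX hY)
  obtain ⟨f, hfP, hf⟩ := exists_independent_transversal G P hPne
    (fun X Y v hX hY => hdisj X Y v (hPX X v hX) (hPX Y v hY))
    (by
      intro X v hv
      rcases hPdeg X v hv with h1 | h1
      · exact Or.inl fun Y hYX u hu hvu => hYX (hdisj Y X u (hPX Y u hu) (h1 u hvu))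
      · refine Or.inr fun s hs => h1 s fun u hu => ⟨(hs u hu).1, fun huX => ?_⟩
        obtain ⟨-, Y, hYX, huY⟩ := hs u hu
        exact hYX (hdisj Y X u (hPX Y u huY) huX))
  choose J hJ using fun X : ι => hPJ X (f X) (hfP X)
  refine ⟨⋃ X, J X, ?_, ?_⟩
  · intro x hx y hy hxy hadj
    obtain ⟨X, hxX⟩ := Set.mem_iUnion.1 hx
    obtain ⟨Y, hyY⟩ := Set.mem_iUnion.1 hy
    by_cases hXY : X = Y
    · subst hXY
      exact (hJ X).indep x hxX y hyY hadj
    -- An edge between different clusters can only join their chosen vertices, and these form an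
    -- independent transversal.
    · have h1 : x = f X := by
        by_contra hne
        exact hXY (hdisj X Y y ((hJ X).inside x hxX hne y hadj) ((hJ Y).subset hyY))
      have h2 : y = f Y := by
        by_contra hne
        exact hXY (hdisj X Y x ((hJ X).subset hxX) ((hJ Y).inside y hyY hne x hadj.symm))
      exact hf X Y hXY (h1 ▸ h2 ▸ hadj)
  · rintro T hT ⟨v, hv⟩
    obtain ⟨X, hX, hvX⟩ := exists_isCluster G v
    have hTX := hX.closed T hT v hv hvX
    obtain ⟨u, huT, hu⟩ := (hJ ⟨X, hX, T, hT, hTX⟩).hits T hT hTX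
    exact ⟨u, huT, Set.mem_iUnion.2 ⟨_, hu⟩⟩

/-- A vertex has no more neighbours than a given set of five neighbours. -/
theorem mem_of_adj_of_card_eq_five {V : Type*} {G : SimpleGraph V}
    (hΔ : ∀ v (s : Finset V), (∀ u ∈ s, G.Adj v u) → s.card ≤ 5) {v : V} {s : Finset V}
    (hs : ∀ u ∈ s, G.Adj v u) (hcard : 5 ≤ s.card) {u : V} (hu : G.Adj v u) : u ∈ s := by
  classical
  by_contra hus
  have := hΔ v (insert u s) (by
    intro w hw
    rcases Finset.mem_insert.1 hw with rfl | hw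
    exacts [hu, hs w hw])
  rw [Finset.card_insert_of_notMem hus] at this
  omega

end FracBrooks
-- Clusters containing an induced `C₈²`.
namespace FracBrooks
theorem square_cycleGraph_eight_adj (i j : Fin 8) :
    (square (SimpleGraph.cycleGraph 8)).Adj i j ↔ j - i = 1 ∨ j - i = 2 ∨ j - i = 6 ∨ j - i = 7 := by
  simp only [square, SimpleGraph.cycleGraph_adj]
  revert i j
  decide

/-- A three-element clique of `C₈²` consists of three consecutive vertices. -/
theorem exists_eq_triple_of_clique : ∀ s : Finset (Fin 8), 3 ≤ s.card →
    (∀ i ∈ s, ∀ j ∈ s, i ≠ j → j - i = 1 ∨ j - i = 2 ∨ j - i = 6 ∨ j - i = 7) →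
    ∃ i, s = {i, i + 1, i + 2} := by decide +kernel

/-- A nonempty vertex set of `C₈²` with minimum degree at least three misses at most one vertex. -/
theorem exists_erase_subset_of_three_neighbors : ∀ s : Finset (Fin 8), s.Nonempty →
    (∀ i ∈ s, 3 ≤ (s.filter fun j => j - i = 1 ∨ j - i = 2 ∨ j - i = 6 ∨ j - i = 7).card) →
    ∃ x, Finset.univ.erase x ⊆ s := by decide +kernel

set_option synthInstance.maxSize 1000 in
set_option synthInstance.maxHeartbeats 200000 in
/-- If `B` is the set of starting points of triples of consecutive vertices with a common outside
neighbour, then one vertex, or two nonadjacent ones, of these triples meet all of them. -/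
theorem exists_pair_meeting_triples : ∀ B : Finset (Fin 8), B.Nonempty →
    (∀ i ∈ B, i + 2 ∈ B → i + 1 ∈ B) →
    (∀ i ∈ B, i + 1 ∈ B → i + 2 ∈ B → i + 3 ∉ B) →
    ∃ a b : Fin 8, (a = b ∨ b - a = 3 ∨ b - a = 4 ∨ b - a = 5) ∧
      (∃ i ∈ B, a = i ∨ a = i + 1 ∨ a = i + 2) ∧
      (∃ i ∈ B, b = i ∨ b = i + 1 ∨ b = i + 2) ∧
      (∀ i ∈ B, (a = i ∨ a = i + 1 ∨ a = i + 2) ∨ (b = i ∨ b = i + 1 ∨ b = i + 2)) ∧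
      (a = b → a ∈ B → a - 1 ∈ B → a - 2 ∉ B) := by decide +kernel

section SquareOfCycle

variable {V : Type*} {G : SimpleGraph V}

theorem embedding_adj_iff (f : square (SimpleGraph.cycleGraph 8) ↪g G) (i j : Fin 8) :
    G.Adj (f i) (f j) ↔ j - i = 1 ∨ j - i = 2 ∨ j - i = 6 ∨ j - i = 7 := by
  rw [f.map_adj_iff, square_cycleGraph_eight_adj]

theorem IsTarget.three_le_card_filter [DecidableEq V] [DecidableRel G.Adj] {T : Finset V}
    (hT : IsTarget G T) {v : V} (hv : v ∈ T) : 3 ≤ (T.filter (G.Adj v)).card := by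
  rcases hT with hT | ⟨f, hf⟩
  · have h1 : T.erase v ⊆ T.filter (G.Adj v) := fun u hu => by
      obtain ⟨huv, huT⟩ := Finset.mem_erase.1 hu
      exact Finset.mem_filter.2 ⟨huT, hT.1 hv huT huv.symm⟩
    have h2 := Finset.card_le_card h1
    rw [Finset.card_erase_of_mem hv, hT.2] at h2
    exact h2
  · obtain ⟨i, rfl⟩ := (hf v).1 hv
    have h1 : ({i + 1, i + 2, i + 6} : Finset (Fin 8)).image f ⊆ T.filter (G.Adj (f i)) := by
      intro u hu
      obtain ⟨j, hj, rfl⟩ := Finset.mem_image.1 hu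
      refine Finset.mem_filter.2 ⟨(hf _).2 ⟨j, rfl⟩, (embedding_adj_iff f i j).2 ?_⟩
      clear * - hj
      revert hj; revert i j; decide
    have h2 := Finset.card_le_card h1
    rw [Finset.card_image_of_injective _ f.injective] at h2
    refine le_trans (le_of_eq ?_) h2
    clear * -
    revert i; decide

theorem four_le_card_filter_of_embedding [DecidableEq V] [DecidableRel G.Adj] {T : Finset V}
    (f : square (SimpleGraph.cycleGraph 8) ↪g G) (hf : ∀ v, v ∈ T ↔ ∃ i, f i = v)
    {v : V} (hv : v ∈ T) : 4 ≤ (T.filter (G.Adj v)).card := by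
  obtain ⟨i, rfl⟩ := (hf v).1 hv
  have h1 : ({i + 1, i + 2, i + 6, i + 7} : Finset (Fin 8)).image f ⊆
      T.filter (G.Adj (f i)) := by
    intro u hu
    obtain ⟨j, hj, rfl⟩ := Finset.mem_image.1 hu
    refine Finset.mem_filter.2 ⟨(hf _).2 ⟨j, rfl⟩, (embedding_adj_iff f i j).2 ?_⟩
    clear * - hj
    revert hj; revert i j; decide
  have h2 := Finset.card_le_card h1
  rw [Finset.card_image_of_injective _ f.injective] at h2
  refine le_trans (le_of_eq ?_) h2
  clear * -
  revert i; decide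

/-- Four of the at most five neighbours of a vertex of the copy already lie in the copy. -/
theorem eq_of_adj_of_notMem_range
    (hΔ : ∀ v (s : Finset V), (∀ u ∈ s, G.Adj v u) → s.card ≤ 5)
    (f : square (SimpleGraph.cycleGraph 8) ↪g G) {i : Fin 8} {w w' : V}
    (hw : ∀ j, f j ≠ w) (hw' : ∀ j, f j ≠ w') (h : G.Adj (f i) w) (h' : G.Adj (f i) w') :
    w' = w := by
  classical
  have hmem := mem_of_adj_of_card_eq_five hΔ (v := f i)
    (s := insert w (({i + 1, i + 2, i + 6, i + 7} : Finset (Fin 8)).image f)) (by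
      intro u hu
      rcases Finset.mem_insert.1 hu with rfl | hu
      · exact h
      · obtain ⟨j, hj, rfl⟩ := Finset.mem_image.1 hu
        refine (embedding_adj_iff f i j).2 ?_
        clear * - hj
        revert hj; revert i j; decide) (by
      rw [Finset.card_insert_of_notMem (by
        intro hu
        obtain ⟨j, -, hj⟩ := Finset.mem_image.1 hu
        exact hw j hj), Finset.card_image_of_injective _ f.injective]
      refine le_of_eq ?_
      clear * -
      revert i; decide) h'
  rcases Finset.mem_insert.1 hmem with hmem | hmem
  · exact hmem
  · obtain ⟨j, -, hj⟩ := Finset.mem_image.1 hmem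
    exact absurd hj (hw' j)

theorem card_filter_notMem_range_le_one [DecidableEq V]
    (hΔ : ∀ v (s : Finset V), (∀ u ∈ s, G.Adj v u) → s.card ≤ 5)
    (f : square (SimpleGraph.cycleGraph 8) ↪g G) (i : Fin 8) (T : Finset V)
    (hT : ∀ u ∈ T, G.Adj (f i) u) :
    (T \ Finset.univ.image f).card ≤ 1 := by
  refine Finset.card_le_one.2 fun w hw w' hw' => ?_
  simp only [Finset.mem_sdiff, Finset.mem_image, Finset.mem_univ, true_and, not_exists] at hw hw'
  exact (eq_of_adj_of_notMem_range hΔ f hw.2 hw'.2 (hT w hw.1) (hT w' hw'.1)).symm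

theorem inter_image_eq [DecidableEq V] (f : square (SimpleGraph.cycleGraph 8) ↪g G)
    (T : Finset V) :
    T ∩ Finset.univ.image f = (Finset.univ.filter fun j => f j ∈ T).image f := by
  ext v
  simp only [Finset.mem_inter, Finset.mem_image, Finset.mem_univ, true_and, Finset.mem_filter]
  constructor
  · rintro ⟨h, j, rfl⟩
    exact ⟨j, h, rfl⟩
  · rintro ⟨j, h, rfl⟩
    exact ⟨h, j, rfl⟩

/-- A `K₄` meeting an induced `C₈²` consists of three consecutive vertices and one other. -/
theorem exists_triple_of_isNClique
    (hΔ : ∀ v (s : Finset V), (∀ u ∈ s, G.Adj v u) → s.card ≤ 5)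
    (f : square (SimpleGraph.cycleGraph 8) ↪g G) {T : Finset V} (hT : G.IsNClique 4 T)
    {i : Fin 8} (hi : f i ∈ T) :
    ∃ w ∈ T, (∀ j, f j ≠ w) ∧ (∀ u ∈ T, (∀ j, f j ≠ u) → u = w) ∧
      ∃ j, f j ∈ T ∧ f (j + 1) ∈ T ∧ f (j + 2) ∈ T := by
  classical
  set I : Finset (Fin 8) := Finset.univ.filter fun j => f j ∈ T with hI
  have hsub : T \ Finset.univ.image f = (T.erase (f i)) \ Finset.univ.image f := by
    ext v
    simp only [Finset.mem_sdiff, Finset.mem_erase, Finset.mem_image, Finset.mem_univ, true_and]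
    refine ⟨fun h => ⟨⟨fun h' => h.2 ⟨i, h'.symm⟩, h.1⟩, h.2⟩, fun h => ⟨h.1.2, h.2⟩⟩
  -- All other vertices of `T` are neighbours of `f i`, and at most one neighbour of `f i` is
  -- outside the copy. Hence the copy contains at least three vertices of `T`.
  have h1 : (T \ Finset.univ.image f).card ≤ 1 := by
    rw [hsub]
    refine card_filter_notMem_range_le_one hΔ f i _ fun u hu => ?_
    obtain ⟨hne, hu⟩ := Finset.mem_erase.1 hu
    exact hT.1 hi hu hne.symm
  have h2 := Finset.card_inter_add_card_sdiff T (Finset.univ.image f)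
  rw [inter_image_eq, Finset.card_image_of_injective _ f.injective, hT.2, ← hI] at h2
  obtain ⟨j, hj⟩ := exists_eq_triple_of_clique I (by omega) (by
    intro a ha b hb hab
    rw [← embedding_adj_iff f]
    exact hT.1 (Finset.mem_filter.1 ha).2 (Finset.mem_filter.1 hb).2 (f.injective.ne hab))
  have h3 : I.card ≤ 3 := by rw [hj]; exact Finset.card_le_three
  obtain ⟨w, hw⟩ := Finset.card_eq_one.1 (show (T \ Finset.univ.image f).card = 1 by omega)
  have hmem : ∀ u, u ∈ T \ Finset.univ.image f ↔ u ∈ T ∧ ∀ j, f j ≠ u := by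
    intro u
    simp
  have hww := (hmem w).1 (by rw [hw]; simp)
  have hIm : ∀ a ∈ I, f a ∈ T := fun a ha => (Finset.mem_filter.1 ha).2
  refine ⟨w, hww.1, hww.2, fun u hu hu' => ?_, j, hIm _ (by simp [hj]), hIm _ (by simp [hj]),
    hIm _ (by simp [hj])⟩
  have := (hmem u).2 ⟨hu, hu'⟩
  rwa [hw, Finset.mem_singleton] at this

/-- Two intersecting induced copies of `C₈²` differ in at most one vertex. -/
theorem exists_twin_of_embedding
    (hΔ : ∀ v (s : Finset V), (∀ u ∈ s, G.Adj v u) → s.card ≤ 5)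
    (f g : square (SimpleGraph.cycleGraph 8) ↪g G) {T : Finset V}
    (hg : ∀ v, v ∈ T ↔ ∃ i, g i = v) {i : Fin 8} (hi : f i ∈ T) :
    ∃ x, (∀ j, j ≠ x → f j ∈ T) ∧
      (∀ u ∈ T, ∀ v ∈ T, (∀ j, f j ≠ u) → (∀ j, f j ≠ v) → u = v) ∧
      (f x ∈ T ∨ ∃ w ∈ T, (∀ j, f j ≠ w) ∧ ∀ j, G.Adj (f x) (f j) → G.Adj (f j) w) := by
  classical
  set I : Finset (Fin 8) := Finset.univ.filter fun j => f j ∈ T with hI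
  have hIm : ∀ a, a ∈ I ↔ f a ∈ T := fun a => by simp [hI]
  have hTcard : T.card = 8 := by
    have : T = Finset.univ.image g := by ext v; simp [hg]
    rw [this, Finset.card_image_of_injective _ g.injective]; rfl
  have hsplit : ∀ j, f j ∈ T → 4 ≤ (I.filter fun k => G.Adj (f j) (f k)).card +
      (T.filter (G.Adj (f j)) \ Finset.univ.image f).card := by
    intro j hj
    have h1 := four_le_card_filter_of_embedding g hg hj
    have h2 := Finset.card_inter_add_card_sdiff (T.filter (G.Adj (f j))) (Finset.univ.image f)
    rw [inter_image_eq, Finset.card_image_of_injective _ f.injective] at h2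
    have h3 : (Finset.univ.filter fun k => f k ∈ T.filter (G.Adj (f j))) =
        I.filter fun k => G.Adj (f j) (f k) := by
      ext k; simp [hI]
    rw [h3] at h2
    omega
  -- Each common vertex has four neighbours in `T`, of which at most one is outside the copy `f`.
  obtain ⟨x, hx⟩ := exists_erase_subset_of_three_neighbors I ⟨i, (hIm i).2 hi⟩ (by
    intro j hj
    have h1 := hsplit j ((hIm j).1 hj)
    have h2 := card_filter_notMem_range_le_one hΔ f j (T.filter (G.Adj (f j)))
      (fun u hu => (Finset.mem_filter.1 hu).2)
    simp only [embedding_adj_iff] at h1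
    omega)
  have hx' : ∀ j, j ≠ x → f j ∈ T := fun j hj => (hIm j).1 (hx (by simp [hj]))
  have hcard : (T \ Finset.univ.image f).card ≤ 1 := by
    have h2 := Finset.card_inter_add_card_sdiff T (Finset.univ.image f)
    rw [inter_image_eq, Finset.card_image_of_injective _ f.injective, hTcard, ← hI] at h2
    have h3 := Finset.card_le_card hx
    rw [Finset.card_erase_of_mem (Finset.mem_univ _), Finset.card_univ, Fintype.card_fin] at h3
    omega
  have huniq : ∀ u ∈ T, ∀ v ∈ T, (∀ j, f j ≠ u) → (∀ j, f j ≠ v) → u = v := by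
    intro u hu v hv hu' hv'
    exact Finset.card_le_one.1 hcard u (by simp [hu, hu']) v (by simp [hv, hv'])
  refine ⟨x, hx', huniq, ?_⟩
  by_contra! hcon
  obtain ⟨hfx, hcon⟩ := hcon
  -- If `f x` is missing from `T`, each of its neighbours in the copy needs a replacement neighbour
  -- in `T`. By `huniq` the replacement is always the same vertex, a twin of `f x`.
  have key : ∀ j, G.Adj (f x) (f j) → ∃ w ∈ T, (∀ j, f j ≠ w) ∧ G.Adj (f j) w := by
    intro j hj
    have h1 := hsplit j (hx' j fun h => by subst h; exact G.loopless.irrefl _ hj)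
    have h2 : (I.filter fun k => G.Adj (f j) (f k)).card ≤ 3 := by
      have h3 : (I.filter fun k => G.Adj (f j) (f k)) ⊆
          ({j + 1, j + 2, j + 6, j + 7} : Finset (Fin 8)).erase x := by
        intro k hk
        obtain ⟨hk, hjk⟩ := Finset.mem_filter.1 hk
        rw [Finset.mem_erase]
        refine ⟨fun h => hfx (h ▸ (hIm k).1 hk), ?_⟩
        rw [embedding_adj_iff] at hjk
        clear * - hjk
        revert hjk; revert j k; decide
      refine (Finset.card_le_card h3).trans ?_
      rw [embedding_adj_iff] at hj
      clear * - hj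
      revert hj; revert j x; decide
    have h3 : 0 < (T.filter (G.Adj (f j)) \ Finset.univ.image f).card := by omega
    obtain ⟨w, hw⟩ := Finset.card_pos.1 h3
    simp only [Finset.mem_sdiff, Finset.mem_filter, Finset.mem_image, Finset.mem_univ, true_and,
      not_exists] at hw
    exact ⟨w, hw.1.1, hw.2, hw.1.2⟩
  have hadj : G.Adj (f x) (f (x + 1)) := by
    rw [embedding_adj_iff]; clear * -; revert x; decide
  obtain ⟨w, hwT, hw, -⟩ := key _ hadj
  obtain ⟨j, hj, hjw⟩ := hcon w hwT hw
  obtain ⟨w', hwT', hw', hjw'⟩ := key j hj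
  exact hjw (huniq w' hwT' w hwT hw' hw ▸ hjw')

/-- All targets of a cluster containing an induced `C₈²` meet it. -/
theorem exists_mem_of_isTarget
    (hΔ : ∀ v (s : Finset V), (∀ u ∈ s, G.Adj v u) → s.card ≤ 5)
    (f : square (SimpleGraph.cycleGraph 8) ↪g G) {X : Set V} (hX : IsCluster G X)
    (hfX : f 0 ∈ X) {T : Finset V} (hT : IsTarget G T) (hTX : ∀ v ∈ T, v ∈ X) (hne : T.Nonempty) :
    ∃ i, f i ∈ T := by
  classical
  set S : Finset V := Finset.univ.image f with hS
  have hSm : ∀ v, v ∈ S ↔ ∃ i, f i = v := by simp [hS]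
  -- `Y` is closed. A vertex with three neighbours in `S` has three more in any target through it,
  -- so with degree at most 5 that target meets `S`. A target meeting `S` has at most one vertex
  -- outside `S`, whose neighbours in the target then all lie in `S`.
  let Y : Set V := {v | v ∈ S ∨ 3 ≤ (S.filter (G.Adj v)).card}
  have hmeet : ∀ T, IsTarget G T → ∀ v ∈ T, v ∈ Y → ∃ i, f i ∈ T := by
    intro T hT v hvT hvY
    rcases hvY with hvS | hv3
    · obtain ⟨i, rfl⟩ := (hSm v).1 hvS
      exact ⟨i, hvT⟩
    · by_contra! hcon
      have h1 := hT.three_le_card_filter hvT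
      have h2 := hΔ v (T.filter (G.Adj v) ∪ S.filter (G.Adj v)) (by
        intro u hu
        rcases Finset.mem_union.1 hu with hu | hu
        exacts [(Finset.mem_filter.1 hu).2, (Finset.mem_filter.1 hu).2])
      rw [Finset.card_union_of_disjoint] at h2
      · omega
      · rw [Finset.disjoint_left]
        intro u hu hu'
        obtain ⟨i, rfl⟩ := (hSm u).1 (Finset.mem_filter.1 hu').1
        exact hcon i (Finset.mem_filter.1 hu).1
  have hYc : TargetClosed G Y := by
    intro T hT v hvT hvY u huT
    obtain ⟨i, hi⟩ := hmeet T hT v hvT hvY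
    by_cases huS : u ∈ S
    · exact Or.inl huS
    have huniq : ∀ u ∈ T, ∀ v ∈ T, (∀ j, f j ≠ u) → (∀ j, f j ≠ v) → u = v := by
      rcases hT with hT | ⟨g, hg⟩
      · obtain ⟨w, -, -, h, -⟩ := exists_triple_of_isNClique hΔ f hT hi
        intro a ha b hb ha' hb'
        rw [h a ha ha', h b hb hb']
      · obtain ⟨x, -, h, -⟩ := exists_twin_of_embedding hΔ f g hg hi
        exact h
    right
    refine (hT.three_le_card_filter huT).trans (Finset.card_le_card ?_)
    intro a ha
    obtain ⟨haT, hua⟩ := Finset.mem_filter.1 ha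
    refine Finset.mem_filter.2 ⟨?_, hua⟩
    by_contra haS
    rw [hSm] at haS huS
    push Not at haS huS
    exact hua.ne (huniq u huT a haT huS haS)
  obtain ⟨v, hv⟩ := hne
  exact hmeet T hT v hv (hX.subset Y hYc (f 0) hfX (Or.inl ((hSm _).2 ⟨0, rfl⟩)) (hTX v hv))

theorem IsTarget.nonempty {T : Finset V} (hT : IsTarget G T) : T.Nonempty := by
  rcases hT with hT | ⟨f, hf⟩
  · rw [← Finset.card_pos, hT.2]; norm_num
  · exact ⟨f 0, (hf _).2 ⟨0, rfl⟩⟩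

theorem hasChoice_of_embedding
    (hΔ : ∀ v (s : Finset V), (∀ u ∈ s, G.Adj v u) → s.card ≤ 5)
    (f : square (SimpleGraph.cycleGraph 8) ↪g G) {X : Set V} (hX : IsCluster G X)
    (hfX : ∀ i, f i ∈ X) : HasChoice G X := by
  classical
  have hmeet : ∀ T, IsTarget G T → (∀ v ∈ T, v ∈ X) → ∃ i, f i ∈ T := fun T hT hTX =>
    exists_mem_of_isTarget hΔ f hX (hfX 0) hT hTX hT.nonempty
  have huniq : ∀ i w w', (∀ j, f j ≠ w) → (∀ j, f j ≠ w') → G.Adj (f i) w → G.Adj (f i) w' →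
      w' = w := fun i w w' => eq_of_adj_of_notMem_range hΔ f
  -- Every `K₄` in `X` contains a triple of consecutive vertices starting at an index of `B`. A
  -- vertex of such a triple has its unique possible outside neighbour in `X`, so all its neighbours
  -- lie in `X`.
  set B : Finset (Fin 8) := Finset.univ.filter fun i => ∃ w ∈ X, (∀ j, f j ≠ w) ∧
    G.Adj (f i) w ∧ G.Adj (f (i + 1)) w ∧ G.Adj (f (i + 2)) w with hB
  have hBm : ∀ i, i ∈ B ↔ ∃ w ∈ X, (∀ j, f j ≠ w) ∧
    G.Adj (f i) w ∧ G.Adj (f (i + 1)) w ∧ G.Adj (f (i + 2)) w := by simp [hB]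
  have hclique : ∀ T, G.IsNClique 4 T → (∀ v ∈ T, v ∈ X) →
      ∃ j ∈ B, f j ∈ T ∧ f (j + 1) ∈ T ∧ f (j + 2) ∈ T := by
    intro T hT hTX
    obtain ⟨i, hi⟩ := hmeet T (Or.inl hT) hTX
    obtain ⟨w, hwT, hw, -, j, h1, h2, h3⟩ := exists_triple_of_isNClique hΔ f hT hi
    exact ⟨j, (hBm j).2 ⟨w, hTX w hwT, hw, hT.1 h1 hwT (hw _), hT.1 h2 hwT (hw _),
      hT.1 h3 hwT (hw _)⟩, h1, h2, h3⟩
  have hadj : ∀ i j, (j - i = 1 ∨ j - i = 2 ∨ j - i = 6 ∨ j - i = 7) → G.Adj (f i) (f j) :=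
    fun i j h => (embedding_adj_iff f i j).2 h
  have e12 : ∀ i : Fin 8, i + 1 + 1 = i + 2 := by decide
  have e13 : ∀ i : Fin 8, i + 1 + 2 = i + 3 := by decide
  have e21 : ∀ i : Fin 8, i + 2 + 1 = i + 3 := by decide
  have e22 : ∀ i : Fin 8, i + 2 + 2 = i + 4 := by decide
  have e31 : ∀ i : Fin 8, i + 3 + 1 = i + 4 := by decide
  have e32 : ∀ i : Fin 8, i + 3 + 2 = i + 5 := by decide
  by_cases hBne : B.Nonempty
  -- Triples sharing a vertex have the same outside neighbour `w`. So two triples two steps apart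
  -- force the one between them, and four consecutive triples would give `w` six neighbours.
  · obtain ⟨a, b, hab, ha, hb, hcov, htw⟩ := exists_pair_meeting_triples B hBne (by
      intro i hi hi2
      obtain ⟨w, hwX, hw, -, h1, h2⟩ := (hBm i).1 hi
      obtain ⟨w', -, hw', h3, h4, -⟩ := (hBm _).1 hi2
      obtain rfl := huniq _ _ _ hw hw' h2 h3
      rw [e21] at h4
      exact (hBm _).2 ⟨w', hwX, hw, h1, by rwa [e12], by rwa [e13]⟩) (by
      intro i h0 h1 h2 h3
      obtain ⟨w, -, hw, a0, a1, a2⟩ := (hBm _).1 h0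
      obtain ⟨w1, -, hw1, b1, -, b3⟩ := (hBm _).1 h1
      obtain ⟨w2, -, hw2, c2, -, c4⟩ := (hBm _).1 h2
      obtain ⟨w3, -, hw3, d3, -, d5⟩ := (hBm _).1 h3
      obtain rfl := huniq _ _ _ hw hw1 a1 b1
      obtain rfl := huniq _ _ _ hw hw2 a2 c2
      rw [e13] at b3
      obtain rfl := huniq _ _ _ hw hw3 b3 d3
      rw [e22] at c4
      rw [e32] at d5
      have := hΔ w3 (({i, i + 1, i + 2, i + 3, i + 4, i + 5} : Finset (Fin 8)).image f) (by
        intro u hu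
        obtain ⟨j, hj, rfl⟩ := Finset.mem_image.1 hu
        simp only [Finset.mem_insert, Finset.mem_singleton] at hj
        rcases hj with rfl | rfl | rfl | rfl | rfl | rfl
        exacts [a0.symm, a1.symm, a2.symm, b3.symm, c4.symm, d5.symm])
      rw [Finset.card_image_of_injective _ f.injective] at this
      clear * - this
      revert this; revert i; decide)
    have hin : ∀ a, (∃ i ∈ B, a = i ∨ a = i + 1 ∨ a = i + 2) → ∀ u, G.Adj (f a) u → u ∈ X := by
      rintro a ⟨i, hi, ha⟩ u hu
      by_cases hur : ∃ j, f j = u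
      · obtain ⟨j, rfl⟩ := hur
        exact hfX j
      · push Not at hur
        obtain ⟨w, hwX, hw, h0, h1, h2⟩ := (hBm _).1 hi
        have h3 : G.Adj (f a) w := by rcases ha with rfl | rfl | rfl <;> assumption
        rwa [huniq _ _ _ hw hur h3 hu]
    have hnadj : ¬ G.Adj (f a) (f b) := by
      rw [embedding_adj_iff]
      clear * - hab
      revert hab; revert a b; decide
    refine HasChoice.of_inside (p := f a) (J := {f a, f b}) ⟨by simp, ?_, ?_, ?_, ?_⟩ (hin a ha)
    · rintro x (rfl | rfl)
      exacts [hfX a, hfX b]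
    · rintro x (rfl | rfl) y (rfl | rfl)
      exacts [G.loopless.irrefl _, hnadj, fun h => hnadj h.symm, G.loopless.irrefl _]
    · rintro x (rfl | rfl) hne
      exacts [absurd rfl hne, hin b hb]
    · intro T hT hTX
      suffices h : f a ∈ T ∨ f b ∈ T by
        rcases h with h | h
        exacts [⟨_, h, by simp⟩, ⟨_, h, by simp⟩]
      rcases hT with hT | ⟨g, hg⟩
      · obtain ⟨j, hj, h0, h1, h2⟩ := hclique T hT hTX
        rcases hcov j hj with h | h
        · left; rcases h with rfl | rfl | rfl <;> assumption
        · right; rcases h with rfl | rfl | rfl <;> assumption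
      · obtain ⟨i, hi⟩ := hmeet T (Or.inr ⟨g, hg⟩) hTX
        obtain ⟨x, hx, -, hxw⟩ := exists_twin_of_embedding hΔ f g hg hi
        -- A second `C₈²` misses at most `f x`, so only `a = b = x` is critical. A twin of `f a`
        -- would then put `a`, `a - 1`, `a - 2` into `B`, against `htw`.
        by_cases hax : a = x
        swap
        · exact Or.inl (hx a hax)
        by_cases hbx : b = x
        swap
        · exact Or.inr (hx b hbx)
        subst hbx
        subst hax
        rcases hxw with h | ⟨w, hwT, hw, hxw⟩
        · exact Or.inl h
        exfalso
        obtain ⟨i, hi, hai⟩ := ha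
        obtain ⟨w', -, hw', h0, h1, h2⟩ := (hBm _).1 hi
        have hww' : w' = w := by
          rcases hai with rfl | rfl | rfl
          · exact huniq (a + 1) _ _ hw hw' (hxw _ (hadj _ _ (by clear * -; revert a; decide))) h1
          · exact huniq i _ _ hw hw' (hxw _ (hadj _ _ (by clear * -; revert i; decide))) h0
          · exact huniq i _ _ hw hw' (hxw _ (hadj _ _ (by clear * -; revert i; decide))) h0
        subst hww'
        have hwX := hTX _ hwT
        have haw : G.Adj (f a) w' := by rcases hai with rfl | rfl | rfl <;> assumption
        have m2 := hxw (a - 2) (hadj _ _ (by clear * -; revert a; decide))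
        have m1 := hxw (a - 1) (hadj _ _ (by clear * -; revert a; decide))
        have p1 := hxw (a + 1) (hadj _ _ (by clear * -; revert a; decide))
        have p2 := hxw (a + 2) (hadj _ _ (by clear * -; revert a; decide))
        have f1 : a - 1 + 1 = a := by clear * -; revert a; decide
        have f2 : a - 1 + 2 = a + 1 := by clear * -; revert a; decide
        have f3 : a - 2 + 1 = a - 1 := by clear * -; revert a; decide
        have f4 : a - 2 + 2 = a := by clear * -; revert a; decide
        exact htw rfl ((hBm _).2 ⟨w', hwX, hw, haw, p1, p2⟩)
          ((hBm _).2 ⟨w', hwX, hw, m1, by rwa [f1], by rwa [f2]⟩)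
          ((hBm _).2 ⟨w', hwX, hw, m2, by rwa [f3], by rwa [f4]⟩)
  have hB0 : ∀ i, i ∉ B := fun i hi => hBne ⟨i, hi⟩
  -- With `B` empty, `X` contains no `K₄`. If `f x` has a twin `w` in `X`, then `w` is the only
  -- outside neighbour of `f (x + 1)`. A target missing `f (x + 1)` would make `w` its twin as well
  -- and put `x` into `B`.
  by_cases htwin : ∃ x, ∃ w ∈ X, (∀ j, f j ≠ w) ∧ ∀ j, G.Adj (f x) (f j) → G.Adj (f j) w
  · obtain ⟨x, w, hwX, hw, hxw⟩ := htwin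
    have h1 := hxw (x + 1) (hadj _ _ (by clear * -; revert x; decide))
    have h2 := hxw (x + 2) (hadj _ _ (by clear * -; revert x; decide))
    refine HasChoice.of_inside (IsHitting.singleton (p := f (x + 1)) (hfX _) ?_) ?_
    · intro T hT hTX
      rcases hT with hT | ⟨g, hg⟩
      · obtain ⟨j, hj, -⟩ := hclique T hT hTX
        exact absurd hj (hB0 j)
      obtain ⟨i, hi⟩ := hmeet T (Or.inr ⟨g, hg⟩) hTX
      obtain ⟨x', hx', -, hxw'⟩ := exists_twin_of_embedding hΔ f g hg hi
      by_cases hxx : x + 1 = x'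
      swap
      · exact hx' _ hxx
      subst hxx
      rcases hxw' with h | ⟨w', hwT', hw', hxw'⟩
      · exact h
      exfalso
      have h2' := hxw' (x + 2) (hadj _ _ (by clear * -; revert x; decide))
      obtain rfl := huniq _ _ _ hw hw' h2 h2'
      have h0 := hxw' x (hadj _ _ (by clear * -; revert x; decide))
      exact hB0 x ((hBm x).2 ⟨w', hwX, hw, h0, h1, h2⟩)
    · intro u hu
      by_cases hur : ∃ j, f j = u
      · obtain ⟨j, rfl⟩ := hur
        exact hfX j
      · push Not at hur
        rwa [huniq _ _ _ hw hur h1 hu]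
  · have hall : ∀ T, IsTarget G T → (∀ v ∈ T, v ∈ X) → ∀ j, f j ∈ T := by
      intro T hT hTX j
      rcases hT with hT | ⟨g, hg⟩
      · obtain ⟨j, hj, -⟩ := hclique T hT hTX
        exact absurd hj (hB0 j)
      obtain ⟨i, hi⟩ := hmeet T (Or.inr ⟨g, hg⟩) hTX
      obtain ⟨x, hx, -, hxw⟩ := exists_twin_of_embedding hΔ f g hg hi
      by_cases hjx : j = x
      · rcases hxw with h | ⟨w, hwT, hw, h⟩
        · rwa [hjx]
        · exact absurd ⟨x, w, hTX w hwT, hw, h⟩ htwin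
      · exact hx j hjx
    -- Without twins every target in `X` contains the whole copy, so all eight vertices are
    -- candidates, each with at most one neighbour outside `X`.
    refine ⟨Finset.univ.image f, ⟨f 0, by simp⟩, ?_, ?_⟩
    · intro p hp
      obtain ⟨j, -, rfl⟩ := Finset.mem_image.1 hp
      exact ⟨_, IsHitting.singleton (hfX j) fun T hT hTX => hall T hT hTX j⟩
    · intro p hp
      obtain ⟨j, -, rfl⟩ := Finset.mem_image.1 hp
      right
      intro s hs
      have h1 := card_filter_notMem_range_le_one hΔ f j s fun u hu => (hs u hu).1
      rw [Finset.sdiff_eq_self_of_disjoint] at h1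
      · rw [Finset.card_image_of_injective _ f.injective, Finset.card_univ, Fintype.card_fin]
        omega
      · rw [Finset.disjoint_left]
        intro u hu hur
        obtain ⟨j, -, rfl⟩ := Finset.mem_image.1 hur
        exact (hs _ hu).2 (hfX j)

end SquareOfCycle
end FracBrooks

/-! ### Clusters with a single `K₄`, or with two `K₄`s sharing three vertices. -/

namespace FracBrooks

section Cliques

variable {V : Type*} {G : SimpleGraph V} {X : Set V}

theorem IsCluster.subset_of_cliques (hX : IsCluster G X)
    (hK : ∀ T, IsTarget G T → (∀ v ∈ T, v ∈ X) → G.IsNClique 4 T) {Y : Set V}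
    (hY : ∀ K, G.IsNClique 4 K → (∀ v ∈ K, v ∈ X) → ∀ v ∈ K, v ∈ Y → ∀ u ∈ K, u ∈ Y)
    {v : V} (hvX : v ∈ X) (hvY : v ∈ Y) : X ⊆ Y := by
  refine (hX.subset (X ∩ Y) ?_ v hvX ⟨hvX, hvY⟩).trans Set.inter_subset_right
  intro T hT a haT ha u hu
  have hTX := hX.closed T hT a haT ha.1
  exact ⟨hTX u hu, hY T (hK T hT hTX) hTX a haT ha.2 u hu⟩

/-- All four vertices are candidates: each has three neighbours in the clique, hence at most two
outside `X`. -/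
theorem hasChoice_of_unique_clique
    (hΔ : ∀ v (s : Finset V), (∀ u ∈ s, G.Adj v u) → s.card ≤ 5) {C : Finset V}
    (hC : G.IsNClique 4 C) (hCX : ∀ v ∈ C, v ∈ X)
    (huniq : ∀ T, IsTarget G T → (∀ v ∈ T, v ∈ X) → T = C) : HasChoice G X := by
  classical
  refine ⟨C, Finset.card_pos.1 (by rw [hC.2]; norm_num), fun p hp => ⟨_, IsHitting.singleton
    (hCX p hp) fun T hT hTX => (huniq T hT hTX).symm ▸ hp⟩, fun p hp => Or.inr fun s hs => ?_⟩
  have h1 := hΔ p (s ∪ C.erase p) (by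
    intro u hu
    rcases Finset.mem_union.1 hu with hu | hu
    · exact (hs u hu).1
    · obtain ⟨hne, hu⟩ := Finset.mem_erase.1 hu
      exact hC.1 hp hu hne.symm)
  rw [Finset.card_union_of_disjoint, Finset.card_erase_of_mem hp, hC.2] at h1
  · rw [hC.2]; omega
  · rw [Finset.disjoint_left]
    exact fun u hu hu' => (hs u hu).2 (hCX u (Finset.mem_of_mem_erase hu'))

/-- Either all `K₄`s in `X` contain the triangle `C ∩ C'`, whose vertices have at most one neighbour
outside `X` and serve as candidates, or some vertex of the triangle lies in all targets of `X` and
has no neighbour outside `X`. -/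
theorem hasChoice_of_card_inter_eq_three [DecidableEq V]
    (hΔ : ∀ v (s : Finset V), (∀ u ∈ s, G.Adj v u) → s.card ≤ 5)
    (h5 : ∀ s, ¬ G.IsNClique 5 s) (hX : IsCluster G X)
    (hK : ∀ T, IsTarget G T → (∀ v ∈ T, v ∈ X) → G.IsNClique 4 T)
    {C C' : Finset V} (hC : G.IsNClique 4 C) (hC' : G.IsNClique 4 C')
    (hCX : ∀ v ∈ C, v ∈ X) (hCX' : ∀ v ∈ C', v ∈ X) (hcard : (C ∩ C').card = 3) :
    HasChoice G X := by
  have hTC : ∀ t ∈ C ∩ C', t ∈ C := fun t ht => (Finset.mem_inter.1 ht).1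
  have hTC' : ∀ t ∈ C ∩ C', t ∈ C' := fun t ht => (Finset.mem_inter.1 ht).2
  have hunion : (C ∪ C').card = 5 := by
    have := Finset.card_union_add_card_inter C C'
    rw [hC.2, hC'.2] at this
    omega
  have hTadj : ∀ t ∈ C ∩ C', ∀ u ∈ C ∪ C', u ≠ t → G.Adj t u := by
    intro t ht u hu hne
    rcases Finset.mem_union.1 hu with hu | hu
    · exact hC.1 (hTC t ht) hu hne.symm
    · exact hC'.1 (hTC' t ht) hu hne.symm
  by_cases hall : ∀ K, G.IsNClique 4 K → (∀ v ∈ K, v ∈ X) → ∀ t ∈ C ∩ C', t ∈ K → C ∩ C' ⊆ K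
  · obtain ⟨t₀, ht₀⟩ : (C ∩ C').Nonempty := Finset.card_pos.1 (by omega)
    have hmeet : ∀ K, G.IsNClique 4 K → (∀ v ∈ K, v ∈ X) → ∀ v ∈ K,
        (∃ L, G.IsNClique 4 L ∧ C ∩ C' ⊆ L ∧ v ∈ L) → C ∩ C' ⊆ K := by
      rintro K hKc hKX v hvK ⟨L, hL, hTL, hvL⟩
      by_contra hcon
      have hdisj : ∀ t ∈ C ∩ C', t ∉ K := fun t ht htK => hcon (hall K hKc hKX t ht htK)
      -- A `K₄` avoiding the triangle but meeting a `K₄` that contains it would give the common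
      -- vertex six neighbours.
      have h1 := hΔ v (K.erase v ∪ (C ∩ C')) (by
        intro u hu
        rcases Finset.mem_union.1 hu with hu | hu
        · obtain ⟨hne, hu⟩ := Finset.mem_erase.1 hu
          exact hKc.1 hvK hu hne.symm
        · exact hL.1 hvL (hTL hu) fun h => hdisj u hu (h ▸ hvK))
      rw [Finset.card_union_of_disjoint, Finset.card_erase_of_mem hvK, hKc.2, hcard] at h1
      · omega
      · rw [Finset.disjoint_left]
        exact fun u hu hu' => hdisj u hu' (Finset.mem_of_mem_erase hu)
    have hXY : X ⊆ {v | ∃ L, G.IsNClique 4 L ∧ C ∩ C' ⊆ L ∧ v ∈ L} :=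
      hX.subset_of_cliques hK (fun K hKc hKX v hvK hv u hu =>
        ⟨K, hKc, hmeet K hKc hKX v hvK hv, hu⟩) (hCX t₀ (hTC t₀ ht₀))
        ⟨C, hC, Finset.inter_subset_left, hTC t₀ ht₀⟩
    refine ⟨C ∩ C', ⟨t₀, ht₀⟩, fun p hp => ⟨_, IsHitting.singleton (hCX p (hTC p hp))
      fun T hT hTX => ?_⟩, fun p hp => Or.inr fun s hs => ?_⟩
    · obtain ⟨v, hv⟩ := hT.nonempty
      exact hmeet T (hK T hT hTX) hTX v hv (hXY (hTX v hv)) hp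
    · have hpU : p ∈ C ∪ C' := Finset.mem_union_left _ (hTC p hp)
      have h1 := hΔ p (s ∪ (C ∪ C').erase p) (by
        intro u hu
        rcases Finset.mem_union.1 hu with hu | hu
        · exact (hs u hu).1
        · obtain ⟨hne, hu⟩ := Finset.mem_erase.1 hu
          exact hTadj p hp u hu hne)
      rw [Finset.card_union_of_disjoint, Finset.card_erase_of_mem hpU, hunion] at h1
      · omega
      · rw [Finset.disjoint_left]
        intro u hu hu'
        rcases Finset.mem_union.1 (Finset.mem_of_mem_erase hu') with h | h
        exacts [(hs u hu).2 (hCX u h), (hs u hu).2 (hCX' u h)]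
  push Not at hall
  obtain ⟨K, hKc, hKX, t₁, ht₁, ht₁K, hTK⟩ := hall
  obtain ⟨x, hx⟩ := Finset.card_eq_one.1 (show (C \ C').card = 1 by
    have := Finset.card_inter_add_card_sdiff C C'
    rw [hC.2] at this
    omega)
  obtain ⟨y, hy⟩ := Finset.card_eq_one.1 (show (C' \ C).card = 1 by
    have := Finset.card_inter_add_card_sdiff C' C
    rw [hC'.2, Finset.inter_comm] at this
    omega)
  have hx' : x ∈ C ∧ x ∉ C' := Finset.mem_sdiff.1 (by rw [hx]; simp)
  have hy' : y ∈ C' ∧ y ∉ C := Finset.mem_sdiff.1 (by rw [hy]; simp)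
  have hmemC : ∀ v ∈ C, v ∈ C ∩ C' ∨ v = x := by
    intro v hv
    by_cases h : v ∈ C'
    · exact Or.inl (Finset.mem_inter.2 ⟨hv, h⟩)
    · right; simpa [hx] using Finset.mem_sdiff.2 ⟨hv, h⟩
  have hmemC' : ∀ v ∈ C', v ∈ C ∩ C' ∨ v = y := by
    intro v hv
    by_cases h : v ∈ C
    · exact Or.inl (Finset.mem_inter.2 ⟨h, hv⟩)
    · right; simpa [hy] using Finset.mem_sdiff.2 ⟨hv, h⟩
  have hxy : ¬ G.Adj x y := by
    intro hadj
    refine h5 (insert y C) (hC.insert fun b hb => ?_)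
    rcases hmemC b hb with h | rfl
    · exact (hTadj b h y (Finset.mem_union_right _ hy'.1) (by rintro rfl; exact hy'.2 hb)).symm
    · exact hadj.symm
  have hxyne : x ≠ y := by rintro rfl; exact hx'.2 hy'.1
  have hnotboth : ∀ L, G.IsNClique 4 L → x ∈ L → y ∉ L := fun L hL h1 h2 =>
    hxy (hL.1 h1 h2 hxyne)
  obtain ⟨w, hwK, hw⟩ : ∃ w ∈ K, w ∉ C ∪ C' := by
    by_contra! hcon
    by_cases hxK : x ∈ K
    · have : K ⊆ C := by
        intro v hv
        rcases Finset.mem_union.1 (hcon v hv) with h | h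
        · exact h
        · rcases hmemC' v h with h | rfl
          · exact hTC v h
          · exact absurd hv (hnotboth K hKc hxK)
      have := Finset.eq_of_subset_of_card_le this (by rw [hC.2, hKc.2])
      exact hTK (this ▸ Finset.inter_subset_left)
    · have : K ⊆ C' := by
        intro v hv
        rcases Finset.mem_union.1 (hcon v hv) with h | h
        · rcases hmemC v h with h | rfl
          · exact hTC' v h
          · exact absurd hv hxK
        · exact h
      have := Finset.eq_of_subset_of_card_le this (by rw [hC'.2, hKc.2])
      exact hTK (this ▸ Finset.inter_subset_right)
  -- Four neighbours in `C ∪ C'` together with `w` exhaust the degree of `t`.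
  have hN : ∀ t ∈ C ∩ C', t ∈ K → ∀ u, G.Adj t u → u ∈ insert w (C ∪ C') := by
    intro t ht htK u hu
    have htU : t ∈ C ∪ C' := Finset.mem_union_left _ (hTC t ht)
    have := mem_of_adj_of_card_eq_five hΔ (v := t) (s := insert w ((C ∪ C').erase t)) (by
      intro u hu
      rcases Finset.mem_insert.1 hu with rfl | hu
      · exact hKc.1 htK hwK fun h => hw (h ▸ htU)
      · obtain ⟨hne, hu⟩ := Finset.mem_erase.1 hu
        exact hTadj t ht u hu hne) (by
      rw [Finset.card_insert_of_notMem (fun h => hw (Finset.mem_of_mem_erase h)),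
        Finset.card_erase_of_mem htU, hunion]) hu
    exact Finset.insert_subset_insert _ (Finset.erase_subset _ _) this
  have hKY : ∀ u ∈ K, u = w ∨ u ∈ C ∩ C' ∨ u = x ∨ u = y := by
    intro u hu
    by_cases h : u = t₁
    · exact Or.inr (Or.inl (h ▸ ht₁))
    rcases Finset.mem_insert.1 (hN t₁ ht₁ ht₁K u (hKc.1 ht₁K hu (Ne.symm h))) with h | h
    · exact Or.inl h
    · rcases Finset.mem_union.1 h with h | h
      · rcases hmemC u h with h | h
        exacts [Or.inr (Or.inl h), Or.inr (Or.inr (Or.inl h))]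
      · rcases hmemC' u h with h | h
        exacts [Or.inr (Or.inl h), Or.inr (Or.inr (Or.inr h))]
  have ht₁w : t₁ ≠ w := by rintro rfl; exact hw (Finset.mem_union_left _ (hTC _ ht₁))
  have hK2 : ((K.erase t₁).erase w).card = 2 := by
    rw [Finset.card_erase_of_mem (Finset.mem_erase.2 ⟨ht₁w.symm, hwK⟩),
      Finset.card_erase_of_mem ht₁K, hKc.2]
  obtain ⟨p, q, hpq, hpqe⟩ := Finset.card_eq_two.1 hK2
  have hp : p ∈ (K.erase t₁).erase w := by rw [hpqe]; simp
  have hq : q ∈ (K.erase t₁).erase w := by rw [hpqe]; simp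
  simp only [Finset.mem_erase] at hp hq
  -- The two vertices of `K` besides `t₁` and `w` cannot be `x` and `y`, which are nonadjacent. So
  -- `K` contains a second vertex `t₂` of the triangle.
  obtain ⟨t₂, ht₂, ht₂K, ht₂1, r, hrK, hrw, hr1, hr2⟩ : ∃ t₂ ∈ C ∩ C', t₂ ∈ K ∧ t₂ ≠ t₁ ∧
      ∃ r ∈ K, r ≠ w ∧ r ≠ t₁ ∧ r ≠ t₂ := by
    by_cases hpT : p ∈ C ∩ C'
    · exact ⟨p, hpT, hp.2.2, hp.2.1, q, hq.2.2, hq.1, hq.2.1, hpq.symm⟩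
    by_cases hqT : q ∈ C ∩ C'
    · exact ⟨q, hqT, hq.2.2, hq.2.1, p, hp.2.2, hp.1, hp.2.1, hpq⟩
    exfalso
    have h1 := hKY p hp.2.2
    have h2 := hKY q hq.2.2
    simp only [hp.1, hpT, hq.1, hqT, false_or] at h1 h2
    rcases h1 with rfl | rfl <;> rcases h2 with rfl | rfl
    · exact hpq rfl
    · exact hnotboth K hKc hp.2.2 hq.2.2
    · exact hnotboth K hKc hq.2.2 hp.2.2
    · exact hpq rfl
  obtain ⟨t₃, ht₃e⟩ := Finset.card_eq_one.1 (show (((C ∩ C').erase t₁).erase t₂).card = 1 by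
    rw [Finset.card_erase_of_mem (Finset.mem_erase.2 ⟨ht₂1, ht₂⟩), Finset.card_erase_of_mem ht₁,
      hcard])
  have ht₃ : t₃ ≠ t₂ ∧ t₃ ≠ t₁ ∧ t₃ ∈ C ∩ C' := by
    have : t₃ ∈ ((C ∩ C').erase t₁).erase t₂ := by rw [ht₃e]; simp
    simpa only [Finset.mem_erase] using this
  have hTeq : ∀ t ∈ C ∩ C', t ≠ t₁ → t ≠ t₂ → t = t₃ := by
    intro t ht h1 h2
    have : t ∈ ((C ∩ C').erase t₁).erase t₂ := by simp only [Finset.mem_erase]; exact ⟨h2, h1, ht⟩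
    rwa [ht₃e, Finset.mem_singleton] at this
  have hxT : x ∉ C ∩ C' := fun h => hx'.2 (hTC' x h)
  have hyT : y ∉ C ∩ C' := fun h => hy'.2 (hTC y h)
  set Y : Finset V := insert w (C ∪ C') with hY
  have hYadj : ∀ t ∈ C ∩ C', t ∈ K → ∀ u ∈ Y, u ≠ t → G.Adj t u := by
    intro t ht htK u hu hne
    rcases Finset.mem_insert.1 hu with rfl | hu
    · exact hKc.1 htK hwK hne.symm
    · exact hTadj t ht u hu hne
  have hYX : ∀ v ∈ Y, v ∈ X := by
    intro v hv
    rcases Finset.mem_insert.1 hv with rfl | hv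
    · exact hKX _ hwK
    · rcases Finset.mem_union.1 hv with hv | hv
      exacts [hCX v hv, hCX' v hv]
  have hxY : x ∈ Y := by simp [hY, hx'.1]
  have hyY : y ∈ Y := by simp [hY, hy'.1]
  have hTY : ∀ t ∈ C ∩ C', t ∈ Y := fun t ht => by simp [hY, hTC t ht]
  have hmeet : ∀ L, G.IsNClique 4 L → ∀ v ∈ L, v ∈ Y → t₁ ∈ L := by
    intro L hL v hvL hvY
    by_contra h1
    have h2 : t₂ ∉ L := by
      intro h2
      refine h5 (insert t₁ L) (hL.insert fun b hb => ?_)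
      have hbY : b ∈ Y := by
        by_cases hb2 : b = t₂
        · rw [hb2]; exact hTY t₂ ht₂
        · exact hN t₂ ht₂ ht₂K b (hL.1 h2 hb (Ne.symm hb2))
      exact hYadj t₁ ht₁ ht₁K b hbY fun h => h1 (h ▸ hb)
    -- Three neighbours in `L` together with `t₁` and `t₂` are all the neighbours of `z`. So `L`
    -- spreads inside `Y` to `t₃`, and from there to both `x` and `y`, which are nonadjacent.
    have hprop : ∀ z ∈ L, z ∈ Y → ∀ z', G.Adj z z' → z' ≠ t₁ → z' ≠ t₂ → z' ∈ L := by
      intro z hz hzY z' hzz' hz1 hz2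
      by_contra hz'
      have h3 := hΔ z (insert z' (insert t₁ (insert t₂ (L.erase z)))) (by
        intro u hu
        simp only [Finset.mem_insert, Finset.mem_erase] at hu
        rcases hu with rfl | rfl | rfl | ⟨hu, huL⟩
        · exact hzz'
        · exact (hYadj _ ht₁ ht₁K z hzY (by rintro rfl; exact h1 hz)).symm
        · exact (hYadj _ ht₂ ht₂K z hzY (by rintro rfl; exact h2 hz)).symm
        · exact hL.1 hz huL (Ne.symm hu))
      rw [Finset.card_insert_of_notMem (by simp [hz1, hz2, hz']),
        Finset.card_insert_of_notMem (by simp [ht₂1.symm, h1]),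
        Finset.card_insert_of_notMem (by simp [h2]), Finset.card_erase_of_mem hz, hL.2] at h3
      omega
    have hxt : G.Adj x t₃ := (hTadj t₃ ht₃.2.2 x (Finset.mem_union_left _ hx'.1)
      (fun h => hxT (h ▸ ht₃.2.2))).symm
    have hyt : G.Adj y t₃ := (hTadj t₃ ht₃.2.2 y (Finset.mem_union_right _ hy'.1)
      (fun h => hyT (h ▸ ht₃.2.2))).symm
    have hstep : ∀ z ∈ L, (z ∈ C ∩ C' ∨ z = x ∨ z = y) → t₃ ∈ L := by
      rintro z hz (hzT | rfl | rfl)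
      · rwa [← hTeq z hzT (fun h => h1 (h ▸ hz)) (fun h => h2 (h ▸ hz))]
      · exact hprop z hz hxY t₃ hxt ht₃.2.1 ht₃.1
      · exact hprop z hz hyY t₃ hyt ht₃.2.1 ht₃.1
    have h3 : t₃ ∈ L := by
      rcases Finset.mem_insert.1 hvY with rfl | hv
      · have hr := (hKY r hrK).resolve_left hrw
        exact hstep r (hprop v hvL hvY r (hKc.1 hwK hrK hrw.symm) hr1 hr2) hr
      · rcases Finset.mem_union.1 hv with hv | hv
        · rcases hmemC v hv with h | h
          exacts [hstep v hvL (Or.inl h), hstep v hvL (Or.inr (Or.inl h))]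
        · rcases hmemC' v hv with h | h
          exacts [hstep v hvL (Or.inl h), hstep v hvL (Or.inr (Or.inr h))]
    have h4 := hprop t₃ h3 (hTY _ ht₃.2.2) x hxt.symm (fun h => hxT (h ▸ ht₁))
      (fun h => hxT (h ▸ ht₂))
    have h5 := hprop t₃ h3 (hTY _ ht₃.2.2) y hyt.symm (fun h => hyT (h ▸ ht₁))
      (fun h => hyT (h ▸ ht₂))
    exact hnotboth L hL h4 h5
  have hXY : X ⊆ {v | v ∈ Y} := hX.subset_of_cliques hK (fun L hL hLX v hvL hvY u hu => by
    have h1 := hmeet L hL v hvL hvY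
    by_cases hut : u = t₁
    · rw [hut]; exact hTY t₁ ht₁
    · exact hN t₁ ht₁ ht₁K u (hL.1 h1 hu (Ne.symm hut))) (hCX t₁ (hTC t₁ ht₁)) (hTY t₁ ht₁)
  refine HasChoice.of_inside (IsHitting.singleton (hCX t₁ (hTC t₁ ht₁)) fun T hT hTX => ?_)
    fun u hu => hYX u (hN t₁ ht₁ ht₁K u hu)
  obtain ⟨v, hv⟩ := hT.nonempty
  exact hmeet T (hK T hT hTX) v hv (hXY (hTX v hv))

end Cliques
end FracBrooks

/-! ### Chains of pairs and the `K₄`s meeting a longest chain. -/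

namespace FracBrooks

section Chains

variable {V : Type*} {G : SimpleGraph V} {X : Set V}

/-- A chain of pairs `b 0, …, b k` such that any two consecutive pairs form a `K₄`. -/
structure IsPairChain (G : SimpleGraph V) (k : ℕ) (b : ℕ → Fin 2 → V) : Prop where
  inj : ∀ i ≤ k, ∀ j ≤ k, ∀ s t, b i s = b j t → i = j ∧ s = t
  adj_self : ∀ i ≤ k, G.Adj (b i 0) (b i 1)
  adj_succ : ∀ i < k, ∀ s t, G.Adj (b i s) (b (i + 1) t)

/-- The union of the `i`-th and the `j`-th pair. -/
def quad [DecidableEq V] (b : ℕ → Fin 2 → V) (i j : ℕ) : Finset V :=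
  {b i 0, b i 1, b j 0, b j 1}

section Quad

variable [DecidableEq V] {b : ℕ → Fin 2 → V} {k : ℕ}

theorem mem_quad {i j : ℕ} {v : V} : v ∈ quad b i j ↔ (∃ s, v = b i s) ∨ ∃ s, v = b j s := by
  simp [quad, Fin.exists_fin_two, or_assoc]

theorem quad_comm (b : ℕ → Fin 2 → V) (i j : ℕ) : quad b i j = quad b j i := by
  ext v; rw [mem_quad, mem_quad, or_comm]

end Quad

namespace IsPairChain

variable {b : ℕ → Fin 2 → V} {k : ℕ}

theorem adj_of_ne (h : IsPairChain G k b) {i : ℕ} (hi : i ≤ k) {s t : Fin 2} (hst : s ≠ t) :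
    G.Adj (b i s) (b i t) := by
  fin_cases s <;> fin_cases t
  · exact absurd rfl hst
  · exact h.adj_self i hi
  · exact (h.adj_self i hi).symm
  · exact absurd rfl hst

theorem ne (h : IsPairChain G k b) {i j : ℕ} (hi : i ≤ k) (hj : j ≤ k) (hij : i ≠ j)
    (s t : Fin 2) : b i s ≠ b j t := fun heq => hij (h.inj i hi j hj s t heq).1

theorem reverse (h : IsPairChain G k b) : IsPairChain G k fun i => b (k - i) where
  inj i hi j hj s t heq := by
    have := h.inj (k - i) (by omega) (k - j) (by omega) s t heq
    exact ⟨by omega, this.2⟩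
  adj_self i hi := h.adj_self (k - i) (by omega)
  adj_succ i hi s t := by
    have := h.adj_succ (k - (i + 1)) (by omega) t s
    rw [show k - (i + 1) + 1 = k - i by omega] at this
    exact this.symm

variable [DecidableEq V]

theorem card_quad (h : IsPairChain G k b) {i j : ℕ} (hi : i ≤ k) (hj : j ≤ k) (hij : i ≠ j) :
    (quad b i j).card = 4 := by
  have h1 := h.ne hi hj hij
  have h2 := (h.adj_self i hi).ne
  have h3 := (h.adj_self j hj).ne
  rw [quad, Finset.card_insert_of_notMem (by simp [h1, h2]),
    Finset.card_insert_of_notMem (by simp [h1]), Finset.card_pair h3]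

theorem isNClique_quad (h : IsPairChain G k b) {i j : ℕ} (hi : i ≤ k) (hj : j ≤ k) (hij : i ≠ j)
    (hadj : ∀ s t, G.Adj (b i s) (b j t)) : G.IsNClique 4 (quad b i j) := by
  refine ⟨fun u hu v hv huv => ?_, h.card_quad hi hj hij⟩
  rcases mem_quad.1 hu with ⟨s, rfl⟩ | ⟨s, rfl⟩ <;> rcases mem_quad.1 hv with ⟨t, rfl⟩ | ⟨t, rfl⟩
  · exact h.adj_of_ne hi fun hst => huv (hst ▸ rfl)
  · exact hadj s t
  · exact (hadj t s).symm
  · exact h.adj_of_ne hj fun hst => huv (hst ▸ rfl)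

/-- A pair that is joined to two other pairs has no further neighbours. -/
theorem exists_eq_of_adj (hΔ : ∀ v (s : Finset V), (∀ u ∈ s, G.Adj v u) → s.card ≤ 5)
    (h : IsPairChain G k b) {i a c : ℕ} (hi : i ≤ k) (ha : a ≤ k) (hc : c ≤ k) (hia : i ≠ a)
    (hic : i ≠ c) (hac : a ≠ c) (hadja : ∀ s t, G.Adj (b i s) (b a t))
    (hadjc : ∀ s t, G.Adj (b i s) (b c t)) {s : Fin 2} {v : V} (hv : G.Adj (b i s) v) :
    ∃ j t, (j = a ∨ j = i ∨ j = c) ∧ v = b j t := by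
  have hs : s ≠ s + 1 := by fin_cases s <;> decide
  have := mem_of_adj_of_card_eq_five hΔ (v := b i s) (s := insert (b i (s + 1)) (quad b a c)) (by
      intro u hu
      rcases Finset.mem_insert.1 hu with rfl | hu
      · exact h.adj_of_ne hi hs
      · rcases mem_quad.1 hu with ⟨t, rfl⟩ | ⟨t, rfl⟩
        exacts [hadja s t, hadjc s t]) (by
      rw [Finset.card_insert_of_notMem, h.card_quad ha hc hac]
      rw [mem_quad]
      rintro (⟨t, ht⟩ | ⟨t, ht⟩)
      exacts [h.ne hi ha hia _ _ ht, h.ne hi hc hic _ _ ht]) hv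
  rcases Finset.mem_insert.1 this with rfl | this
  · exact ⟨i, s + 1, Or.inr (Or.inl rfl), rfl⟩
  · rcases mem_quad.1 this with ⟨t, rfl⟩ | ⟨t, rfl⟩
    exacts [⟨a, t, Or.inl rfl, rfl⟩, ⟨c, t, Or.inr (Or.inr rfl), rfl⟩]

theorem exists_eq_of_adj_succ (hΔ : ∀ v (s : Finset V), (∀ u ∈ s, G.Adj v u) → s.card ≤ 5)
    (h : IsPairChain G k b) {i : ℕ} (hi : i + 2 ≤ k) {s : Fin 2} {v : V}
    (hv : G.Adj (b (i + 1) s) v) : ∃ j t, (j = i ∨ j = i + 1 ∨ j = i + 2) ∧ v = b j t :=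
  h.exists_eq_of_adj hΔ (by omega) (by omega) hi (by omega) (by omega) (by omega)
    (fun s t => (h.adj_succ i (by omega) t s).symm) (h.adj_succ (i + 1) (by omega)) hv

/-- An interior vertex has all its neighbours in its own and the two adjacent pairs. The two quads
there cover `K` and share a vertex of `K`, so one of them contains three vertices of `K` and equals
it by `hinter`. -/
theorem eq_quad_of_mem_succ (hΔ : ∀ v (s : Finset V), (∀ u ∈ s, G.Adj v u) → s.card ≤ 5)
    (hinter : ∀ K L, G.IsNClique 4 K → G.IsNClique 4 L → (∀ v ∈ K, v ∈ X) → (∀ v ∈ L, v ∈ X) →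
      3 ≤ (K ∩ L).card → K = L)
    (h : IsPairChain G k b) (hbX : ∀ i ≤ k, ∀ s, b i s ∈ X) {K : Finset V} (hK : G.IsNClique 4 K)
    (hKX : ∀ v ∈ K, v ∈ X) {i : ℕ} (hi : i + 2 ≤ k) {s : Fin 2} (hs : b (i + 1) s ∈ K) :
    K = quad b i (i + 1) ∨ K = quad b (i + 1) (i + 2) := by
  have hQ : ∀ j < k, K = quad b j (j + 1) ∨ (K ∩ quad b j (j + 1)).card ≤ 2 := by
    intro j hj
    by_cases hcard : 3 ≤ (K ∩ quad b j (j + 1)).card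
    · left
      refine hinter _ _ hK (h.isNClique_quad hj.le hj (by omega) (h.adj_succ j hj)) hKX ?_ hcard
      intro v hv
      rcases mem_quad.1 hv with ⟨t, rfl⟩ | ⟨t, rfl⟩
      exacts [hbX _ hj.le t, hbX _ hj t]
    · right; omega
  rcases hQ i (by omega) with h1 | h1
  · exact Or.inl h1
  rcases hQ (i + 1) (by omega) with h2 | h2
  · exact Or.inr h2
  exfalso
  have h3 := Finset.card_union_add_card_inter (K ∩ quad b i (i + 1))
    (K ∩ quad b (i + 1) (i + 1 + 1))
  have h4 : K ⊆ (K ∩ quad b i (i + 1)) ∪ (K ∩ quad b (i + 1) (i + 1 + 1)) := by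
    intro v hv
    have hvq : v ∈ quad b i (i + 1) ∨ v ∈ quad b (i + 1) (i + 1 + 1) := by
      by_cases hvs : v = b (i + 1) s
      · exact Or.inl (mem_quad.2 (Or.inr ⟨s, hvs⟩))
      obtain ⟨j, t, rfl | rfl | rfl, rfl⟩ := h.exists_eq_of_adj_succ hΔ hi (hK.1 hs hv (Ne.symm hvs))
      exacts [Or.inl (mem_quad.2 (Or.inl ⟨t, rfl⟩)), Or.inl (mem_quad.2 (Or.inr ⟨t, rfl⟩)),
        Or.inr (mem_quad.2 (Or.inr ⟨t, rfl⟩))]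
    rcases hvq with hvq | hvq
    · exact Finset.mem_union_left _ (Finset.mem_inter.2 ⟨hv, hvq⟩)
    · exact Finset.mem_union_right _ (Finset.mem_inter.2 ⟨hv, hvq⟩)
  have h5 := Finset.card_le_card h4
  rw [hK.2] at h5
  have h6 : 0 < ((K ∩ quad b i (i + 1)) ∩ (K ∩ quad b (i + 1) (i + 1 + 1))).card := by
    refine Finset.card_pos.2 ⟨b (i + 1) s, ?_⟩
    simp only [Finset.mem_inter, mem_quad]
    exact ⟨⟨hs, Or.inr ⟨s, rfl⟩⟩, hs, Or.inl ⟨s, rfl⟩⟩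
  omega

/-- A `K₄` that contains a vertex of a pair, but avoids a pair joined to it, contains the pair. -/
theorem forall_mem_of_mem (hΔ : ∀ v (s : Finset V), (∀ u ∈ s, G.Adj v u) → s.card ≤ 5)
    (h : IsPairChain G k b) {K : Finset V} (hK : G.IsNClique 4 K) {i j : ℕ} (hi : i ≤ k)
    (hj : j ≤ k) (hij : i ≠ j) (hadj : ∀ s t, G.Adj (b i s) (b j t)) (hjK : ∀ t, b j t ∉ K)
    {s : Fin 2} (hs : b i s ∈ K) (t : Fin 2) : b i t ∈ K := by
  by_contra ht
  have hst : s ≠ t := by rintro rfl; exact ht hs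
  have h1 := hΔ (b i s) (insert (b i t) (insert (b j 0) (insert (b j 1) (K.erase (b i s))))) (by
    intro u hu
    simp only [Finset.mem_insert, Finset.mem_erase] at hu
    rcases hu with rfl | rfl | rfl | ⟨hne, hu⟩
    · exact h.adj_of_ne hi hst
    · exact hadj _ _
    · exact hadj _ _
    · exact hK.1 hs hu hne.symm)
  have h2 := h.ne hi hj hij
  rw [Finset.card_insert_of_notMem (by simp [h2, ht]),
    Finset.card_insert_of_notMem (by simp [hjK, (h.adj_self j hj).ne]),
    Finset.card_insert_of_notMem (by simp [hjK]), Finset.card_erase_of_mem hs, hK.2] at h1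
  omega

/-- A `K₄` at the first pair that avoids the second contains the whole first pair. Its other two
vertices are the last pair, or else they would prolong the chain. -/
theorem eq_quad_of_mem_zero (hΔ : ∀ v (s : Finset V), (∀ u ∈ s, G.Adj v u) → s.card ≤ 5)
    (hinter : ∀ K L, G.IsNClique 4 K → G.IsNClique 4 L → (∀ v ∈ K, v ∈ X) → (∀ v ∈ L, v ∈ X) →
      3 ≤ (K ∩ L).card → K = L)
    (h : IsPairChain G k b) (hk : 2 ≤ k) (hbX : ∀ i ≤ k, ∀ s, b i s ∈ X)
    (hmax : ¬ ∃ b', IsPairChain G (k + 1) b' ∧ ∀ i ≤ k + 1, ∀ s, b' i s ∈ X)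
    {K : Finset V} (hK : G.IsNClique 4 K)
    (hKX : ∀ v ∈ K, v ∈ X) {s : Fin 2} (hs : b 0 s ∈ K) :
    K = quad b 0 1 ∨ K = quad b 0 k := by
  by_cases h1 : ∃ t, b 1 t ∈ K
  · obtain ⟨t, ht⟩ := h1
    rcases h.eq_quad_of_mem_succ hΔ hinter hbX hK hKX (i := 0) hk ht with h2 | h2
    · exact Or.inl h2
    · exfalso
      rw [h2, mem_quad] at hs
      rcases hs with ⟨t, ht⟩ | ⟨t, ht⟩
      exacts [h.ne (by omega) (by omega) (by omega) _ _ ht,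
        h.ne (by omega) (by omega) (by omega) _ _ ht]
  push Not at h1
  right
  have hint : ∀ i, i + 2 ≤ k → ∀ t, b (i + 1) t ∉ K := by
    intro i hi t ht
    rcases h.eq_quad_of_mem_succ hΔ hinter hbX hK hKX hi ht with h2 | h2
    · rw [h2, mem_quad] at hs
      rcases hs with ⟨t', ht'⟩ | ⟨t', ht'⟩
      · obtain rfl := (h.inj _ (by omega) _ (by omega) _ _ ht').1
        exact h1 t ht
      · exact h.ne (by omega) (by omega) (by omega) _ _ ht'
    · rw [h2, mem_quad] at hs
      rcases hs with ⟨t', ht'⟩ | ⟨t', ht'⟩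
      exacts [h.ne (by omega) (by omega) (by omega) _ _ ht',
        h.ne (by omega) (by omega) (by omega) _ _ ht']
  have h0 : ∀ t, b 0 t ∈ K := h.forall_mem_of_mem hΔ hK (by omega) (by omega) (by omega)
    (h.adj_succ 0 (by omega)) h1 hs
  by_cases h2 : ∃ t, b k t ∈ K
  · obtain ⟨t, ht⟩ := h2
    have hk' := h.forall_mem_of_mem hΔ hK (i := k) (j := k - 2 + 1) le_rfl (by omega) (by omega)
      (fun s t => by
        have := h.adj_succ (k - 2 + 1) (by omega) t s
        rw [show k - 2 + 1 + 1 = k by omega] at this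
        exact this.symm) (hint (k - 2) (by omega)) ht
    refine (Finset.eq_of_subset_of_card_le ?_ ?_).symm
    · intro v hv
      rcases mem_quad.1 hv with ⟨t, rfl⟩ | ⟨t, rfl⟩
      exacts [h0 t, hk' t]
    · rw [hK.2, h.card_quad (by omega) le_rfl (by omega)]
  push Not at h2
  exfalso
  have hall : ∀ i ≤ k, i ≠ 0 → ∀ t, b i t ∉ K := by
    intro i hi hi0 t
    by_cases hik : i = k
    · exact hik ▸ h2 t
    · have := hint (i - 1) (by omega) t
      rwa [show i - 1 + 1 = i by omega] at this
  obtain ⟨c, d, hcd, hcde⟩ := Finset.card_eq_two.1 (show ((K.erase (b 0 0)).erase (b 0 1)).card = 2 by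
    rw [Finset.card_erase_of_mem (Finset.mem_erase.2 ⟨(h.adj_self 0 (by omega)).ne.symm, h0 1⟩),
      Finset.card_erase_of_mem (h0 0), hK.2])
  have hc : c ∈ (K.erase (b 0 0)).erase (b 0 1) := by rw [hcde]; simp
  have hd : d ∈ (K.erase (b 0 0)).erase (b 0 1) := by rw [hcde]; simp
  simp only [Finset.mem_erase] at hc hd
  let e : Fin 2 → V := ![c, d]
  have he : ∀ s, e s ∈ K ∧ ∀ t, e s ≠ b 0 t := by
    intro s
    fin_cases s
    · exact ⟨hc.2.2, Fin.forall_fin_two.2 ⟨hc.2.1, hc.1⟩⟩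
    · exact ⟨hd.2.2, Fin.forall_fin_two.2 ⟨hd.2.1, hd.1⟩⟩
  have heb : ∀ s, ∀ i ≤ k, ∀ t, e s ≠ b i t := by
    intro s i hi t
    by_cases hi0 : i = 0
    · subst hi0; exact (he s).2 t
    · exact fun heq => hall i hi hi0 t (heq ▸ (he s).1)
  -- The new pair `e` is put in front, and `b` is shifted by one.
  refine hmax ⟨fun n => Nat.casesOn n e b, ⟨?_, ?_, ?_⟩, ?_⟩
  · rintro (_ | i) hi (_ | j) hj s t heq
    · refine ⟨rfl, ?_⟩
      fin_cases s <;> fin_cases t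
      exacts [rfl, absurd heq hcd, absurd heq hcd.symm, rfl]
    · exact absurd heq (heb s j (by omega) t)
    · exact absurd heq.symm (heb t i (by omega) s)
    · obtain ⟨h3, h4⟩ := h.inj i (by omega) j (by omega) s t heq
      exact ⟨by rw [h3], h4⟩
  · rintro (_ | i) hi
    · exact hK.1 hc.2.2 hd.2.2 hcd
    · exact h.adj_self i (by omega)
  · rintro (_ | i) hi s t
    · exact hK.1 (he s).1 (h0 t) ((he s).2 t)
    · exact h.adj_succ i (by omega) s t
  · rintro (_ | i) hi s
    · exact hKX _ (he s).1
    · exact hbX i (by omega) s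

theorem eq_quad_of_mem (hΔ : ∀ v (s : Finset V), (∀ u ∈ s, G.Adj v u) → s.card ≤ 5)
    (hinter : ∀ K L, G.IsNClique 4 K → G.IsNClique 4 L → (∀ v ∈ K, v ∈ X) → (∀ v ∈ L, v ∈ X) →
      3 ≤ (K ∩ L).card → K = L)
    (h : IsPairChain G k b) (hk : 2 ≤ k) (hbX : ∀ i ≤ k, ∀ s, b i s ∈ X)
    (hmax : ¬ ∃ b', IsPairChain G (k + 1) b' ∧ ∀ i ≤ k + 1, ∀ s, b' i s ∈ X)
    {K : Finset V} (hK : G.IsNClique 4 K)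
    (hKX : ∀ v ∈ K, v ∈ X) {i : ℕ} (hi : i ≤ k) {s : Fin 2} (hs : b i s ∈ K) :
    (∃ j < k, K = quad b j (j + 1)) ∨ K = quad b 0 k := by
  by_cases hi0 : i = 0
  · subst hi0
    rcases h.eq_quad_of_mem_zero hΔ hinter hk hbX hmax hK hKX hs with h1 | h1
    exacts [Or.inl ⟨0, by omega, h1⟩, Or.inr h1]
  by_cases hik : i = k
  · subst hik
    rcases h.reverse.eq_quad_of_mem_zero hΔ hinter hk (fun j _ s => hbX _ (by omega) s) hmax hK hKX
      (s := s) (by simpa using hs) with h1 | h1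
    · refine Or.inl ⟨i - 1, by omega, ?_⟩
      rw [quad_comm, h1]
      simp only [quad, Nat.sub_zero, show i - 1 + 1 = i by omega]
    · right
      rw [quad_comm, h1]
      simp only [quad, Nat.sub_zero, Nat.sub_self]
  · obtain ⟨m, rfl⟩ : ∃ m, i = m + 1 := ⟨i - 1, by omega⟩
    rcases h.eq_quad_of_mem_succ hΔ hinter hbX hK hKX (i := m) (by omega) hs with h1 | h1
    exacts [Or.inl ⟨m, by omega, h1⟩, Or.inl ⟨m + 1, by omega, h1⟩]

end IsPairChain
end Chains
end FracBrooks

/-! ### Choices from chains, closed chains, and the case distinction for clusters. -/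

namespace FracBrooks

section ClosedChains

variable {V : Type*} {G : SimpleGraph V} {X : Set V} {b : ℕ → Fin 2 → V} {k : ℕ}

/-- All neighbours of the `i`-th pair lie in the chain, and those in other pairs have indices of
the other parity. -/
def IsInner (G : SimpleGraph V) (k : ℕ) (b : ℕ → Fin 2 → V) (i : ℕ) : Prop :=
  ∀ s v, G.Adj (b i s) v → ∃ j ≤ k, ∃ t, v = b j t ∧ (j = i ∨ ¬ (Even j ↔ Even i))

theorem IsInner.mem {i : ℕ} (h : IsInner G k b i) (hbX : ∀ i ≤ k, ∀ s, b i s ∈ X) {s : Fin 2}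
    {v : V} (hv : G.Adj (b i s) v) : v ∈ X := by
  obtain ⟨j, hj, t, rfl, -⟩ := h s v hv
  exact hbX j hj t

namespace IsPairChain

variable [DecidableEq V]

theorem isInner (hΔ : ∀ v (s : Finset V), (∀ u ∈ s, G.Adj v u) → s.card ≤ 5)
    (h : IsPairChain G k b) {i : ℕ} (hi0 : 0 < i) (hik : i < k) : IsInner G k b i := by
  obtain ⟨m, rfl⟩ : ∃ m, i = m + 1 := ⟨i - 1, by omega⟩
  intro s v hv
  obtain ⟨j, t, hj, rfl⟩ := h.exists_eq_of_adj_succ hΔ (i := m) (by omega) hv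
  refine ⟨j, by omega, t, rfl, ?_⟩
  rcases hj with rfl | rfl | rfl
  · right; grind
  · left; rfl
  · right; grind

/-- Taking one vertex of each pair of the parity of `p` yields a hitting set. -/
theorem exists_isHitting (h : IsPairChain G k b) (hbX : ∀ i ≤ k, ∀ s, b i s ∈ X)
    (hT : ∀ T, IsTarget G T → (∀ v ∈ T, v ∈ X) →
      (∃ i < k, T = quad b i (i + 1)) ∨ (T = quad b 0 k ∧ Odd k))
    {p : ℕ} (hp : p ≤ k) (s : Fin 2)
    (hin : ∀ i ≤ k, i ≠ p → (Even i ↔ Even p) → IsInner G k b i) :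
    ∃ J, IsHitting G X (b p s) J := by
  refine ⟨{v | ∃ i ≤ k, (Even i ↔ Even p) ∧ v = b i s}, ⟨p, hp, Iff.rfl, rfl⟩, ?_, ?_, ?_, ?_⟩
  · rintro v ⟨i, hi, -, rfl⟩
    exact hbX i hi s
  · have key : ∀ i ≤ k, i ≠ p → (Even i ↔ Even p) → ∀ j ≤ k, j ≠ i → (Even j ↔ Even p) →
        ¬ G.Adj (b i s) (b j s) := by
      intro i hi hip hpar j hj hji hpar' hadj
      obtain ⟨j', hj', t, heq, hor⟩ := hin i hi hip hpar s _ hadj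
      obtain rfl := (h.inj j hj j' hj' s t heq).1
      rcases hor with hor | hor
      · exact hji hor
      · exact hor (hpar'.trans hpar.symm)
    rintro x ⟨i, hi, hip, rfl⟩ y ⟨j, hj, hjp, rfl⟩ hadj
    by_cases hij : i = j
    · subst hij; exact G.loopless.irrefl _ hadj
    by_cases h1 : i = p
    · exact key j hj (fun h2 => hij (h1.trans h2.symm)) hjp i hi hij hip hadj.symm
    · exact key i hi h1 hip j hj (Ne.symm hij) hjp hadj
  · rintro x ⟨i, hi, hip, rfl⟩ hne u hu
    exact (hin i hi (by rintro rfl; exact hne rfl) hip).mem hbX hu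
  · intro T hT' hTX
    rcases hT T hT' hTX with ⟨i, hi, rfl⟩ | ⟨rfl, hk⟩
    · by_cases hpar : Even i ↔ Even p
      · exact ⟨b i s, mem_quad.2 (Or.inl ⟨s, rfl⟩), i, hi.le, hpar, rfl⟩
      · refine ⟨b (i + 1) s, mem_quad.2 (Or.inr ⟨s, rfl⟩), i + 1, hi, ?_, rfl⟩
        rw [Nat.even_add_one]
        tauto
    · by_cases hpar : Even p
      · exact ⟨b 0 s, mem_quad.2 (Or.inl ⟨s, rfl⟩), 0, by omega, by simp [hpar], rfl⟩
      · refine ⟨b k s, mem_quad.2 (Or.inr ⟨s, rfl⟩), k, le_rfl, ?_, rfl⟩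
        rw [← Nat.not_even_iff_odd] at hk
        tauto

theorem card_le_two_of_adj (hΔ : ∀ v (s : Finset V), (∀ u ∈ s, G.Adj v u) → s.card ≤ 5)
    (h : IsPairChain G k b) (hbX : ∀ i ≤ k, ∀ s, b i s ∈ X) {i j : ℕ} (hi : i ≤ k) (hj : j ≤ k)
    (hij : i ≠ j) (hadj : ∀ s t, G.Adj (b i s) (b j t)) (s : Fin 2) {S : Finset V}
    (hS : ∀ u ∈ S, G.Adj (b i s) u ∧ u ∉ X) : S.card ≤ 2 := by
  have hq := h.isNClique_quad hi hj hij hadj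
  have hm : b i s ∈ quad b i j := mem_quad.2 (Or.inl ⟨s, rfl⟩)
  have h1 := hΔ (b i s) (S ∪ (quad b i j).erase (b i s)) (by
    intro u hu
    rcases Finset.mem_union.1 hu with hu | hu
    · exact (hS u hu).1
    · obtain ⟨hne, hu⟩ := Finset.mem_erase.1 hu
      exact hq.1 hm hu hne.symm)
  rw [Finset.card_union_of_disjoint, Finset.card_erase_of_mem hm, hq.2] at h1
  · omega
  · rw [Finset.disjoint_left]
    intro u hu hu'
    rcases mem_quad.1 (Finset.mem_of_mem_erase hu') with ⟨t, rfl⟩ | ⟨t, rfl⟩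
    exacts [(hS _ hu).2 (hbX i hi t), (hS _ hu).2 (hbX j hj t)]

/-- Alternate pairs give the hitting set. In a closed chain, which has evenly many pairs since `k`
is odd, no pair has neighbours outside the chain. In an open one with `k` even, the odd indices
avoid both ends. -/
theorem hasChoice (hΔ : ∀ v (s : Finset V), (∀ u ∈ s, G.Adj v u) → s.card ≤ 5)
    (h : IsPairChain G k b) (hk : 2 ≤ k) (hbX : ∀ i ≤ k, ∀ s, b i s ∈ X)
    (hT : ∀ T, IsTarget G T → (∀ v ∈ T, v ∈ X) →
      (∃ i < k, T = quad b i (i + 1)) ∨ (T = quad b 0 k ∧ G.IsNClique 4 T))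
    (hodd : (∀ s t, G.Adj (b 0 s) (b k t)) → Odd k) : HasChoice G X := by
  have hT' : ∀ T, IsTarget G T → (∀ v ∈ T, v ∈ X) →
      (∃ i < k, T = quad b i (i + 1)) ∨ (T = quad b 0 k ∧ Odd k) := by
    intro T hTt hTX
    rcases hT T hTt hTX with h1 | ⟨rfl, hc⟩
    · exact Or.inl h1
    · exact Or.inr ⟨rfl, hodd fun s t => hc.1 (mem_quad.2 (Or.inl ⟨s, rfl⟩))
        (mem_quad.2 (Or.inr ⟨t, rfl⟩)) (h.ne (by omega) le_rfl (by omega) s t)⟩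
  by_cases hcl : ∀ s t, G.Adj (b 0 s) (b k t)
  · have hkodd := hodd hcl
    have h0 : IsInner G k b 0 := by
      intro s v hv
      obtain ⟨j, t, hj, rfl⟩ := h.exists_eq_of_adj hΔ (i := 0) (a := 1) (c := k) (by omega)
        (by omega) le_rfl (by omega) (by omega) (by omega) (h.adj_succ 0 (by omega)) hcl hv
      refine ⟨j, by omega, t, rfl, ?_⟩
      rcases hj with rfl | rfl | rfl
      · right; simp
      · left; rfl
      · right; rw [← Nat.not_even_iff_odd] at hkodd; simp [hkodd]
    obtain ⟨J, hJ⟩ := h.exists_isHitting hbX hT' (p := 0) (by omega) 0 (by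
      intro i hi hi0 hpar
      refine h.isInner hΔ (by omega) (lt_of_le_of_ne hi ?_)
      rintro rfl
      rw [← Nat.not_even_iff_odd] at hkodd
      simp [hkodd] at hpar)
    exact HasChoice.of_inside hJ fun u hu => h0.mem hbX hu
  · rcases Nat.even_or_odd k with hke | hko
    · have h1 : IsInner G k b 1 := h.isInner hΔ (by omega) (by omega)
      obtain ⟨J, hJ⟩ := h.exists_isHitting hbX hT' (p := 1) (by omega) 0 (by
        intro i hi hi0 hpar
        have : ¬ Even i := by simp [hpar]
        refine h.isInner hΔ (Nat.pos_of_ne_zero ?_) (lt_of_le_of_ne hi ?_)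
        · rintro rfl; simp at this
        · rintro rfl; exact this hke)
      exact HasChoice.of_inside hJ fun u hu => h1.mem hbX hu
    · have hko' := Nat.not_even_iff_odd.2 hko
      -- In an open chain with `k` odd, each parity class contains exactly one end. The four end
      -- vertices are the candidates, each with at most two neighbours outside `X`.
      refine ⟨quad b 0 k, ⟨b 0 0, mem_quad.2 (Or.inl ⟨0, rfl⟩)⟩, ?_, ?_⟩
      · intro p hp
        rcases mem_quad.1 hp with ⟨s, rfl⟩ | ⟨s, rfl⟩
        · refine h.exists_isHitting hbX hT' (by omega) s ?_
          intro i hi hi0 hpar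
          refine h.isInner hΔ (by omega) (lt_of_le_of_ne hi ?_)
          rintro rfl
          simp [hko'] at hpar
        · refine h.exists_isHitting hbX hT' le_rfl s ?_
          intro i hi hik hpar
          refine h.isInner hΔ (Nat.pos_of_ne_zero ?_) (lt_of_le_of_ne hi hik)
          rintro rfl
          simp [hko'] at hpar
      · intro p hp
        right
        intro S hS
        rw [h.card_quad (by omega) le_rfl (by omega)]
        suffices h2 : S.card ≤ 2 by omega
        rcases mem_quad.1 hp with ⟨s, rfl⟩ | ⟨s, rfl⟩
        · exact h.card_le_two_of_adj hΔ hbX (j := 1) (by omega) (by omega) (by omega)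
            (h.adj_succ 0 (by omega)) s hS
        · refine h.card_le_two_of_adj hΔ hbX (j := k - 1) le_rfl (by omega) (by omega) ?_ s hS
          intro s t
          have := h.adj_succ (k - 1) (by omega) t s
          rw [show k - 1 + 1 = k by omega] at this
          exact this.symm

/-- A closed chain is all of a connected graph. -/
theorem nonempty_iso (hΔ : ∀ v (s : Finset V), (∀ u ∈ s, G.Adj v u) → s.card ≤ 5)
    (hconn : G.Connected) (h : IsPairChain G k b) (hk : 2 ≤ k)
    (hcl : ∀ s t, G.Adj (b 0 s) (b k t)) :
    Nonempty (G ≃g strongProduct (SimpleGraph.cycleGraph (k + 1))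
      (SimpleGraph.completeGraph (Fin 2))) := by
  have hnb : ∀ i ≤ k, ∀ s v, G.Adj (b i s) v → ∃ j ≤ k, ∃ t, v = b j t ∧
      (j = i ∨ j = i + 1 ∨ i = j + 1 ∨ (i = 0 ∧ j = k) ∨ (i = k ∧ j = 0)) := by
    intro i hi s v hv
    by_cases hi0 : i = 0
    · subst hi0
      obtain ⟨j, t, hj, rfl⟩ := h.exists_eq_of_adj hΔ (i := 0) (a := 1) (c := k) (by omega)
        (by omega) le_rfl (by omega) (by omega) (by omega) (h.adj_succ 0 (by omega)) hcl hv
      exact ⟨j, by omega, t, rfl, by omega⟩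
    by_cases hik : i = k
    · subst hik
      obtain ⟨j, t, hj, rfl⟩ := h.exists_eq_of_adj hΔ (i := i) (a := i - 1) (c := 0) (by omega)
        (by omega) (by omega) (by omega) (by omega) (by omega) (by
          intro s t
          have := h.adj_succ (i - 1) (by omega) t s
          rw [show i - 1 + 1 = i by omega] at this
          exact this.symm) (fun s t => (hcl t s).symm) hv
      exact ⟨j, by omega, t, rfl, by omega⟩
    · obtain ⟨m, rfl⟩ : ∃ m, i = m + 1 := ⟨i - 1, by omega⟩
      obtain ⟨j, t, hj, rfl⟩ := h.exists_eq_of_adj_succ hΔ (i := m) (by omega) hv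
      exact ⟨j, by omega, t, rfl, by omega⟩
  -- No edge leaves the closed chain, so by connectedness it contains every vertex.
  have hsurj : ∀ v, ∃ i ≤ k, ∃ s, v = b i s := by
    intro v
    obtain ⟨w⟩ := hconn.preconnected (b 0 0) v
    have key : ∀ {x y : V} (_ : G.Walk x y), (∃ i ≤ k, ∃ s, x = b i s) →
        ∃ i ≤ k, ∃ s, y = b i s := by
      intro x y w
      induction w with
      | nil => exact id
      | cons hadj _ ih =>
        rintro ⟨i, hi, s, rfl⟩
        obtain ⟨j, hj, t, rfl, -⟩ := hnb i hi s _ hadj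
        exact ih ⟨j, hj, t, rfl⟩
    exact key w ⟨0, by omega, 0, rfl⟩
  let φ : Fin (k + 1) × Fin 2 → V := fun q => b q.1 q.2
  have hφ : Function.Bijective φ := by
    constructor
    · rintro ⟨i, s⟩ ⟨j, t⟩ heq
      obtain ⟨h1, h2⟩ := h.inj i (by omega) j (by omega) s t heq
      exact Prod.ext (Fin.ext h1) h2
    · intro v
      obtain ⟨i, hi, s, rfl⟩ := hsurj v
      exact ⟨(⟨i, by omega⟩, s), rfl⟩
  have hcyc : ∀ i j : Fin (k + 1), (SimpleGraph.cycleGraph (k + 1)).Adj i j ↔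
      ((j : ℕ) = i + 1 ∨ (i : ℕ) = j + 1 ∨ ((i : ℕ) = 0 ∧ (j : ℕ) = k) ∨
        ((i : ℕ) = k ∧ (j : ℕ) = 0)) := by
    intro i j
    rw [SimpleGraph.cycleGraph_adj']
    have hi := i.2
    have hj := j.2
    rcases lt_trichotomy i j with hij | rfl | hij
    · rw [Fin.coe_sub_iff_lt.2 hij, Fin.coe_sub_iff_le.2 hij.le]
      have : (i : ℕ) < j := hij
      omega
    · simp only [sub_self, Fin.coe_ofNat_eq_mod, Nat.zero_mod]; omega
    · rw [Fin.coe_sub_iff_lt.2 hij, Fin.coe_sub_iff_le.2 hij.le]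
      have : (j : ℕ) < i := hij
      omega
  have hadj : ∀ i ≤ k, ∀ j ≤ k, (j = i + 1 ∨ i = j + 1 ∨ (i = 0 ∧ j = k) ∨ (i = k ∧ j = 0)) →
      ∀ s t, G.Adj (b i s) (b j t) := by
    rintro i hi j hj (rfl | rfl | ⟨rfl, rfl⟩ | ⟨rfl, rfl⟩) s t
    · exact h.adj_succ i hj s t
    · exact (h.adj_succ j hi t s).symm
    · exact hcl s t
    · exact (hcl t s).symm
  refine ⟨(⟨Equiv.ofBijective φ hφ, ?_⟩ : strongProduct (SimpleGraph.cycleGraph (k + 1))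
      (SimpleGraph.completeGraph (Fin 2)) ≃g G).symm⟩
  rintro ⟨i, s⟩ ⟨j, t⟩
  change G.Adj (b i s) (b j t) ↔ (i = j ∧ s ≠ t) ∨
    ((SimpleGraph.cycleGraph (k + 1)).Adj i j ∧ s = t) ∨
    ((SimpleGraph.cycleGraph (k + 1)).Adj i j ∧ s ≠ t)
  rw [hcyc]
  constructor
  · intro hij
    obtain ⟨j', hj', t', heq, hor⟩ := hnb i (by omega) s _ hij
    obtain ⟨h1, -⟩ := h.inj j (by omega) j' hj' t t' heq
    subst h1
    by_cases hst : s = t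
    · subst hst
      rcases hor with hor | hor
      · rw [hor] at hij
        exact absurd hij (G.loopless.irrefl _)
      · exact Or.inr (Or.inl ⟨by omega, rfl⟩)
    · rcases hor with hor | hor
      · exact Or.inl ⟨Fin.ext hor.symm, hst⟩
      · exact Or.inr (Or.inr ⟨by omega, hst⟩)
  · rintro (⟨rfl, hst⟩ | ⟨h1, -⟩ | ⟨h1, -⟩)
    · exact h.adj_of_ne (by omega) hst
    · exact hadj i (by omega) j (by omega) h1 s t
    · exact hadj i (by omega) j (by omega) h1 s t

end IsPairChain

/-- A cluster with only `K₄`s, no two of which share three vertices but some of which share two. -/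
theorem hasChoice_of_card_inter_eq_two [Finite V] [DecidableEq V]
    (hΔ : ∀ v (s : Finset V), (∀ u ∈ s, G.Adj v u) → s.card ≤ 5)
    (h5 : ∀ s, ¬ G.IsNClique 5 s) (hconn : G.Connected)
    (hexc : ∀ l : ℕ, 2 ≤ l → ¬ Nonempty (G ≃g strongProduct
      (SimpleGraph.cycleGraph (2 * l + 1)) (SimpleGraph.completeGraph (Fin 2))))
    (hX : IsCluster G X) (hK : ∀ T, IsTarget G T → (∀ v ∈ T, v ∈ X) → G.IsNClique 4 T)
    (hinter : ∀ K L, G.IsNClique 4 K → G.IsNClique 4 L → (∀ v ∈ K, v ∈ X) → (∀ v ∈ L, v ∈ X) →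
      3 ≤ (K ∩ L).card → K = L)
    {C C' : Finset V} (hC : G.IsNClique 4 C) (hC' : G.IsNClique 4 C')
    (hCX : ∀ v ∈ C, v ∈ X) (hCX' : ∀ v ∈ C', v ∈ X) (hcard : (C ∩ C').card = 2) :
    HasChoice G X := by
  -- The pairs `C \ C'`, `C ∩ C'`, `C' \ C` form a first chain. Finiteness then provides one that
  -- cannot be prolonged.
  have hstart : ∃ b, IsPairChain G 2 b ∧ ∀ i ≤ 2, ∀ s, b i s ∈ X := by
    obtain ⟨c, d, hcd, hcde⟩ := Finset.card_eq_two.1 hcard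
    obtain ⟨p, q, hpq, hpqe⟩ := Finset.card_eq_two.1 (show (C \ C').card = 2 by
      have := Finset.card_inter_add_card_sdiff C C'
      rw [hC.2] at this
      omega)
    obtain ⟨x, y, hxy, hxye⟩ := Finset.card_eq_two.1 (show (C' \ C).card = 2 by
      have := Finset.card_inter_add_card_sdiff C' C
      rw [hC'.2, Finset.inter_comm] at this
      omega)
    have hc : c ∈ C ∧ c ∈ C' := Finset.mem_inter.1 (by rw [hcde]; simp)
    have hd : d ∈ C ∧ d ∈ C' := Finset.mem_inter.1 (by rw [hcde]; simp)
    have hp : p ∈ C ∧ p ∉ C' := Finset.mem_sdiff.1 (by rw [hpqe]; simp)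
    have hq : q ∈ C ∧ q ∉ C' := Finset.mem_sdiff.1 (by rw [hpqe]; simp)
    have hx : x ∈ C' ∧ x ∉ C := Finset.mem_sdiff.1 (by rw [hxye]; simp)
    have hy : y ∈ C' ∧ y ∉ C := Finset.mem_sdiff.1 (by rw [hxye]; simp)
    have n1 : ∀ u v, (u ∈ C ∧ u ∉ C') → (v ∈ C ∧ v ∈ C') → u ≠ v := by
      rintro u v hu hv rfl; exact hu.2 hv.2
    have n2 : ∀ u v, (u ∈ C' ∧ u ∉ C) → (v ∈ C ∧ v ∈ C') → u ≠ v := by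
      rintro u v hu hv rfl; exact hu.2 hv.1
    have n3 : ∀ u v, (u ∈ C' ∧ u ∉ C) → (v ∈ C ∧ v ∉ C') → u ≠ v := by
      rintro u v hu hv rfl; exact hu.2 hv.1
    let e : ℕ → Fin 2 → V := fun n => if n = 0 then ![p, q] else if n = 1 then ![c, d] else ![x, y]
    have e0 : ∀ s, e 0 s ∈ C ∧ e 0 s ∉ C' := Fin.forall_fin_two.2 ⟨hp, hq⟩
    have e1 : ∀ s, e 1 s ∈ C ∧ e 1 s ∈ C' := Fin.forall_fin_two.2 ⟨hc, hd⟩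
    have e2 : ∀ s, e 2 s ∈ C' ∧ e 2 s ∉ C := Fin.forall_fin_two.2 ⟨hx, hy⟩
    refine ⟨e, ⟨?_, ?_, ?_⟩, ?_⟩
    · have inj2 : ∀ {u v : V}, u ≠ v → ∀ s t : Fin 2, ![u, v] s = ![u, v] t → s = t := by
        intro u v huv s t heq
        fin_cases s <;> fin_cases t
        exacts [rfl, absurd heq huv, absurd heq huv.symm, rfl]
      intro i hi j hj s t heq
      interval_cases i <;> interval_cases j
      · exact ⟨rfl, inj2 hpq s t heq⟩
      · exact absurd heq (n1 _ _ (e0 s) (e1 t))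
      · exact absurd heq.symm (n3 _ _ (e2 t) (e0 s))
      · exact absurd heq.symm (n1 _ _ (e0 t) (e1 s))
      · exact ⟨rfl, inj2 hcd s t heq⟩
      · exact absurd heq.symm (n2 _ _ (e2 t) (e1 s))
      · exact absurd heq (n3 _ _ (e2 s) (e0 t))
      · exact absurd heq (n2 _ _ (e2 s) (e1 t))
      · exact ⟨rfl, inj2 hxy s t heq⟩
    · intro i hi
      interval_cases i
      · exact hC.1 hp.1 hq.1 hpq
      · exact hC.1 hc.1 hd.1 hcd
      · exact hC'.1 hx.1 hy.1 hxy
    · intro i hi s t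
      interval_cases i
      · exact hC.1 (e0 s).1 (e1 t).1 (n1 _ _ (e0 s) (e1 t))
      · exact hC'.1 (e1 s).2 (e2 t).1 (n2 _ _ (e2 t) (e1 s)).symm
    · intro i hi s
      interval_cases i
      exacts [hCX _ (e0 s).1, hCX _ (e1 s).1, hCX' _ (e2 s).1]
  obtain ⟨k, hk, ⟨b, h, hbX⟩, hmax⟩ : ∃ k, 2 ≤ k ∧
      (∃ b, IsPairChain G k b ∧ ∀ i ≤ k, ∀ s, b i s ∈ X) ∧
      ¬ ∃ b', IsPairChain G (k + 1) b' ∧ ∀ i ≤ k + 1, ∀ s, b' i s ∈ X := by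
    by_contra! hcon
    have hall : ∀ k, 2 ≤ k → ∃ b, IsPairChain G k b ∧ ∀ i ≤ k, ∀ s, b i s ∈ X := by
      intro k hk
      induction k, hk using Nat.le_induction with
      | base => exact hstart
      | succ k hk ih => exact hcon k hk ih
    obtain ⟨b, hb, -⟩ := hall (Nat.card V + 2) (by omega)
    have := Nat.card_le_card_of_injective
      (fun i : Fin (Nat.card V + 3) => b i 0) (fun i j hij =>
        Fin.ext (hb.inj i (by omega) j (by omega) 0 0 hij).1)
    rw [Nat.card_fin] at this
    omega
  have hcover : ∀ K, G.IsNClique 4 K → (∀ v ∈ K, v ∈ X) → ∀ i ≤ k, ∀ s, b i s ∈ K →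
      (∃ j < k, K = quad b j (j + 1)) ∨ K = quad b 0 k := fun K hKc hKX i hi s hs =>
    h.eq_quad_of_mem hΔ hinter hk hbX hmax hKc hKX hi hs
  have hXZ : X ⊆ {v | ∃ i ≤ k, ∃ s, v = b i s} := by
    refine hX.subset_of_cliques hK ?_ (hbX 0 (by omega) 0) ⟨0, by omega, 0, rfl⟩
    rintro K hKc hKX v hvK ⟨i, hi, s, rfl⟩ u hu
    rcases hcover K hKc hKX i hi s hvK with ⟨j, hj, rfl⟩ | rfl
    · rcases mem_quad.1 hu with ⟨t, rfl⟩ | ⟨t, rfl⟩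
      exacts [⟨j, hj.le, t, rfl⟩, ⟨j + 1, hj, t, rfl⟩]
    · rcases mem_quad.1 hu with ⟨t, rfl⟩ | ⟨t, rfl⟩
      exacts [⟨0, by omega, t, rfl⟩, ⟨k, le_rfl, t, rfl⟩]
  refine h.hasChoice hΔ hk hbX ?_ ?_
  · intro T hT hTX
    obtain ⟨v, hv⟩ := hT.nonempty
    obtain ⟨i, hi, s, rfl⟩ := hXZ (hTX v hv)
    exact (hcover T (hK T hT hTX) hTX i hi s hv).imp_right fun h => ⟨h, hK T hT hTX⟩
  -- A closed chain with `k = 2l` has `2l + 1` pairs. For `l ≥ 2` it is the excluded product, and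
  -- for `l = 1` its three pairs are mutually joined and contain a `K₅`.
  · intro hcl
    by_contra hodd
    rw [Nat.not_odd_iff_even] at hodd
    obtain ⟨l, rfl⟩ := hodd.two_dvd
    by_cases hl : 2 ≤ l
    · exact hexc l hl (h.nonempty_iso hΔ hconn hk hcl)
    obtain rfl : l = 1 := by omega
    refine h5 (insert (b 2 0) (quad b 0 1)) ((h.isNClique_quad (by omega) (by omega) (by omega)
      (h.adj_succ 0 (by omega))).insert ?_)
    intro v hv
    rcases mem_quad.1 hv with ⟨t, rfl⟩ | ⟨t, rfl⟩
    exacts [(hcl t 0).symm, (h.adj_succ 1 (by omega) t 0).symm]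

/-- Every cluster that contains a target has a choice. -/
theorem hasChoice_of_isCluster [Finite V]
    (hΔ : ∀ v (s : Finset V), (∀ u ∈ s, G.Adj v u) → s.card ≤ 5)
    (h5 : ∀ s, ¬ G.IsNClique 5 s) (hconn : G.Connected)
    (hexc : ∀ l : ℕ, 2 ≤ l → ¬ Nonempty (G ≃g strongProduct
      (SimpleGraph.cycleGraph (2 * l + 1)) (SimpleGraph.completeGraph (Fin 2))))
    (hX : IsCluster G X) {C : Finset V} (hC : IsTarget G C) (hCX : ∀ v ∈ C, v ∈ X) :
    HasChoice G X := by
  classical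
  by_cases hK : ∀ T, IsTarget G T → (∀ v ∈ T, v ∈ X) → G.IsNClique 4 T
  swap
  · push Not at hK
    obtain ⟨T, hT, hTX, hT4⟩ := hK
    obtain ⟨f, hf⟩ := hT.resolve_left hT4
    exact hasChoice_of_embedding hΔ f hX fun i => hTX _ ((hf _).2 ⟨i, rfl⟩)
  by_cases h3 : ∃ K L, G.IsNClique 4 K ∧ G.IsNClique 4 L ∧ (∀ v ∈ K, v ∈ X) ∧
      (∀ v ∈ L, v ∈ X) ∧ (K ∩ L).card = 3
  · obtain ⟨K, L, hKc, hLc, hKX, hLX, hcard⟩ := h3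
    exact hasChoice_of_card_inter_eq_three hΔ h5 hX hK hKc hLc hKX hLX hcard
  have hinter : ∀ K L, G.IsNClique 4 K → G.IsNClique 4 L → (∀ v ∈ K, v ∈ X) →
      (∀ v ∈ L, v ∈ X) → 3 ≤ (K ∩ L).card → K = L := by
    intro K L hKc hLc hKX hLX hcard
    have h4 : (K ∩ L).card ≠ 3 := fun h => h3 ⟨K, L, hKc, hLc, hKX, hLX, h⟩
    have hl := Finset.card_le_card (Finset.inter_subset_left (s₁ := K) (s₂ := L))
    rw [hKc.2] at hl
    have e1 := Finset.eq_of_subset_of_card_le (Finset.inter_subset_left (s₁ := K) (s₂ := L))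
      (by rw [hKc.2]; omega)
    have e2 := Finset.eq_of_subset_of_card_le (Finset.inter_subset_right (s₁ := K) (s₂ := L))
      (by rw [hLc.2]; omega)
    exact e1.symm.trans e2
  have hC4 := hK C hC hCX
  by_cases hmeet : ∃ K, G.IsNClique 4 K ∧ (∀ v ∈ K, v ∈ X) ∧ K ≠ C ∧ ∃ v ∈ K, v ∈ C
  · obtain ⟨K, hKc, hKX, hKC, v, hvK, hvC⟩ := hmeet
    refine hasChoice_of_card_inter_eq_two hΔ h5 hconn hexc hX hK hinter hKc hC4 hKX hCX ?_
    have hlt : (K ∩ C).card < 3 := by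
      by_contra hcon
      exact hKC (hinter K C hKc hC4 hKX hCX (by omega))
    -- The union of two `K₄`s through `v` has at most six vertices, so they share at least two.
    have h1 := hΔ v ((K ∪ C).erase v) (by
      intro u hu
      obtain ⟨hne, hu⟩ := Finset.mem_erase.1 hu
      rcases Finset.mem_union.1 hu with hu | hu
      exacts [hKc.1 hvK hu hne.symm, hC4.1 hvC hu hne.symm])
    rw [Finset.card_erase_of_mem (Finset.mem_union_left _ hvK)] at h1
    have h2 := Finset.card_union_add_card_inter K C
    rw [hKc.2, hC4.2] at h2
    omega
  · refine hasChoice_of_unique_clique hΔ hC4 hCX ?_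
    have huniq : ∀ K, G.IsNClique 4 K → (∀ v ∈ K, v ∈ X) → ∀ v ∈ K, v ∈ C → K = C := by
      intro K hKc hKX v hvK hvC
      by_contra hne
      exact hmeet ⟨K, hKc, hKX, hne, v, hvK, hvC⟩
    obtain ⟨c, hc⟩ := hC.nonempty
    have hXC : X ⊆ {v | v ∈ C} := hX.subset_of_cliques hK (fun K hKc hKX v hvK hvC u hu => by
      rw [huniq K hKc hKX v hvK hvC] at hu
      exact hu) (hCX c hc) hc
    intro T hT hTX
    obtain ⟨v, hv⟩ := hT.nonempty
    exact huniq T (hK T hT hTX) hTX v hv (hXC (hTX v hv))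

end ClosedChains
end FracBrooks

/-! ### From targets back to induced copies. -/

theorem lemma7 {V : Type*} [Fintype V] (G : SimpleGraph V) [DecidableRel G.Adj]
    (hconn : G.Connected) (hmax : G.maxDegree ≤ 5) (hclique : G.cliqueNum ≤ 4)
    (hexc : ∀ l : ℕ, 2 ≤ l →
      ¬ Nonempty (G ≃g FracBrooks.strongProduct (SimpleGraph.cycleGraph (2 * l + 1))
        (SimpleGraph.completeGraph (Fin 2)))) :
    ∃ I : Set V, G.IsIndepSet I ∧
      FracBrooks.MeetsInducedCopies I (SimpleGraph.completeGraph (Fin 4)) G ∧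
      FracBrooks.MeetsInducedCopies I (FracBrooks.square (SimpleGraph.cycleGraph 8)) G := by
  classical
  have hΔ : ∀ v (s : Finset V), (∀ u ∈ s, G.Adj v u) → s.card ≤ 5 := by
    intro v s hs
    refine le_trans ?_ ((G.degree_le_maxDegree v).trans hmax)
    rw [← G.card_neighborFinset_eq_degree]
    exact Finset.card_le_card fun u hu => (G.mem_neighborFinset v u).2 (hs u hu)
  have h5 : ∀ s, ¬ G.IsNClique 5 s := by
    intro s hs
    have := hs.1.card_le_cliqueNum
    rw [hs.2] at this
    omega
  obtain ⟨I, hI, hmeet⟩ := FracBrooks.exists_isIndepSet_of_hasChoice G fun X hX T hT hTX =>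
    FracBrooks.hasChoice_of_isCluster hΔ h5 hconn hexc hX hT hTX
  have hT : ∀ T, FracBrooks.IsTarget G T → ∃ v ∈ T, v ∈ I := fun T hT => hmeet T hT hT.nonempty
  refine ⟨I, hI, fun f => ?_, fun f => ?_⟩
  · obtain ⟨v, hv, hvI⟩ := hT (Finset.univ.map f.toEmbedding) (Or.inl ⟨by
      intro x hx y hy hxy
      simp only [Finset.coe_map, Set.mem_image, Finset.mem_coe, Finset.mem_univ, true_and] at hx hy
      obtain ⟨i, rfl⟩ := hx
      obtain ⟨j, rfl⟩ := hy
      exact f.map_adj_iff.2 fun hij => hxy (by rw [hij]), by simp⟩)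
    obtain ⟨i, -, rfl⟩ := Finset.mem_map.1 hv
    exact ⟨i, hvI⟩
  · obtain ⟨v, hv, hvI⟩ := hT (Finset.univ.map f.toEmbedding) (Or.inr ⟨f, by simp⟩)
    obtain ⟨i, -, rfl⟩ := Finset.mem_map.1 hv
    exact ⟨i, hvI⟩
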